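/- Let $n\ge 0$ and let $\mu,\nu\vdash n$ be partitions. Let $\mathbb S_\lambda$ ($\lambda\vdash n$) be the complex Specht modules of $S_n$, let $g(\mu,\nu,\lambda)$ be the multiplicity of $\mathbb S_\lambda$ in $\mathbb S_\mu\otimes\mathbb S_\nu$, and let $s_\mu * s_\nu=\sum_{\lambda\vdash n} g(\mu,\nu,\lambda)\,s_\lambda$ be the Kronecker product of Schur functions. For partitions $\alpha^1,\dots,\alpha^k$ let $c^{\mu}_{\alpha^1\cdots\alpha^k}=\langle s_\mu, s_{\alpha^1}\cdots s_{\alpha^k}\rangle$ be the multi-Littlewood–Richardson coefficient, where $\langle\cdot,\cdot\rangle$ is the inner product on symmetric functions for which the Schur functions are orthonormal. For $\mathbf a=(a_1,\dots,a_k)\in\mathbb Z_{\ge 0}^k$ let $$P(\mu;\mathbf a)=\{(\alpha^1,\dots,\alpha^k):\ \alpha^i\vdash a_i,\ \ell(\alpha^i)\le \ell(\mu)\text{ for all } i,\ \text{ and } c^{\mu}_{\alpha^1\cdots\alpha^k}>0\},$$ and, for a symmetric function $f$, let $M_k(f)$ be the set of $\mathbf a\in\mathbb Z_{\ge0}^k$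 such that the coefficient of $x^{\mathbf a}=x_1^{a_1}\cdots x_k^{a_k}$ in $f(x_1,\dots,x_k)$ is positive. Then: 1. For every $k\ge 0$ and every $\mathbf a\in\mathbb Z_{\ge0}^k$ with $a_1+\dots+a_k=n$, the coefficient of the monomial symmetric function $m_{\mathbf a}$ (that is, $m_\theta$ with $\theta$ the partition of $n$ obtained by sorting $\mathbf a$ and removing zeros) in the monomial expansion of $s_\mu * s_\nu$ is $$\sum_{\alpha^1\vdash a_1,\dots,\alpha^k\vdash a_k} c^{\mu}_{\alpha^1\cdots\alpha^k}\,c^{\nu}_{\alpha^1\cdots\alpha^k}.$$ 2. For every $k\ge 0$ and every $\mathbf a\in\mathbb Z_{\ge0}^k$, the same sum is the coefficient of $x^{\mathbf a}$ in $(s_\mu * s_\nu)(x_1,\dots,x_k)$. 3. For every $k\ge 0$ and every $\mathbf a\in\mathbb Z_{\ge0}^k$, one has $\mathbf a\in M_k(s_\mu * s_\nu)$ if and only if there are partitions $\alpha^i\vdash a_i$ ($i=1,\dots,k$) with $c^{\mu}_{\alpha^1\cdots\alpha^k}>0$ and $c^{\nu}_{\alpha^1\cdots\alpha^k}>0$.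 4. For every $k\ge 0$, $M_k(s_\mu * s_\nu)=\{\mathbf a\in\mathbb Z_{\ge 0}^k:\ P(\mu;\mathbf a)\cap P(\nu;\mathbf a)\ne\emptyset\}$. -/

import Mathlib

noncomputable section

namespace KronMonomials

/-! ### Specht modules and Kronecker coefficients -/

/-- The Young diagram of a partition: its rows are the parts in weakly decreasing order. -/
def diagram {n : ℕ} (p : n.Partition) : YoungDiagram :=
  YoungDiagram.ofRowLens (p.parts.sort (· ≥ ·)) (p.parts.pairwise_sort (· ≥ ·)).sortedGE

/-- A (bijective) Young tableau of shape `p ⊢ n` with entries `Fin n`: it sends every entry to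
the cell `(row, column)` that contains it. -/
abbrev Tableau {n : ℕ} (p : n.Partition) : Type := Fin n ≃ (diagram p).cells

/-- The row of the entry `e` in the tableau `T`. The function `rowOf T` encodes the tabloid `{T}`:
two tableaux have the same tabloid iff every entry lies in the same row of both. -/
def rowOf {n : ℕ} {p : n.Partition} (T : Tableau p) (e : Fin n) : ℕ := (T e).1.1

/-- The column of the entry `e` in the tableau `T`. -/
def colOf {n : ℕ} {p : n.Partition} (T : Tableau p) (e : Fin n) : ℕ := (T e).1.2

/-- The permutation representation of `S_n` on the complex span of all functions
`w : Fin n → ℕ`, where `σ` sends `w` to `w ∘ σ⁻¹`. The tabloids of shape `p`, seen as such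
functions, span a subrepresentation (the permutation module `M^p`). -/
def wordRep (n : ℕ) : Representation ℂ (Equiv.Perm (Fin n)) ((Fin n → ℕ) →₀ ℂ) where
  toFun σ := Finsupp.lmapDomain ℂ ℂ (fun w : Fin n → ℕ => fun e => w (σ⁻¹ e))
  map_one' := by
    ext w
    simp
  map_mul' σ τ := by
    ext w
    simp

/-- The column stabilizer of `T`: the permutations that keep every entry in its column. -/
def colStab {n : ℕ} {p : n.Partition} (T : Tableau p) : Finset (Equiv.Perm (Fin n)) :=
  {σ | ∀ e, colOf T (σ e) = colOf T e}

/-- The polytabloid `e_T = ∑_{σ ∈ C_T} sgn(σ) σ{T}`. -/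
def polytabloid {n : ℕ} {p : n.Partition} (T : Tableau p) : (Fin n → ℕ) →₀ ℂ :=
  ∑ σ ∈ colStab T, ((Equiv.Perm.sign σ : ℤ) : ℂ) • wordRep n σ (Finsupp.single (rowOf T) 1)

theorem wordRep_polytabloid {n : ℕ} {p : n.Partition} (τ : Equiv.Perm (Fin n)) (T : Tableau p) :
    wordRep n τ (polytabloid T) = polytabloid (τ.symm.trans T : Tableau p) := by
  have hrow : Finsupp.single (rowOf (τ.symm.trans T : Tableau p)) (1 : ℂ)
      = wordRep n τ (Finsupp.single (rowOf T) 1) := by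
    simp only [wordRep, MonoidHom.coe_mk, OneHom.coe_mk, Finsupp.lmapDomain_apply,
      Finsupp.mapDomain_single]
    rfl
  unfold polytabloid
  rw [map_sum, hrow]
  refine Finset.sum_bij' (fun σ _ => τ * σ * τ⁻¹) (fun σ _ => τ⁻¹ * σ * τ) ?_ ?_ ?_ ?_ ?_
  · intro σ hσ
    simp only [colStab, Finset.mem_filter, Finset.mem_univ, true_and] at hσ ⊢
    intro e
    simpa [colOf] using hσ (τ⁻¹ e)
  · intro σ hσ
    simp only [colStab, Finset.mem_filter, Finset.mem_univ, true_and] at hσ ⊢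
    intro e
    simpa [colOf] using hσ (τ e)
  · intro σ _
    group
  · intro σ _
    group
  · intro σ _
    rw [map_smul]
    have h1 : Equiv.Perm.sign (τ * σ * τ⁻¹) = Equiv.Perm.sign σ := by
      rw [map_mul, map_mul, map_inv, mul_right_comm, mul_inv_cancel, one_mul]
    rw [h1, ← Module.End.mul_apply, ← Module.End.mul_apply, ← map_mul, ← map_mul]
    congr 3
    group

/-- The Specht module of the partition `p ⊢ n` over `ℂ`: the span of all polytabloids `e_T`,
with `T` ranging over all tableaux of shape `p`. -/
def spechtSub {n : ℕ} (p : n.Partition) : Subrepresentation (wordRep n) where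
  toSubmodule := Submodule.span ℂ (Set.range (polytabloid (p := p)))
  apply_mem_toSubmodule τ v hv := by
    have h := Submodule.mem_map_of_mem (f := wordRep n τ) hv
    rw [Submodule.map_span] at h
    refine Submodule.span_mono ?_ h
    rintro _ ⟨_, ⟨T, rfl⟩, rfl⟩
    exact ⟨_, (wordRep_polytabloid τ T).symm⟩

/-- The Specht module as a representation of `S_n`. -/
abbrev specht {n : ℕ} (p : n.Partition) :
    Representation ℂ (Equiv.Perm (Fin n)) (spechtSub p).toSubmodule :=
  (spechtSub p).toRepresentation

/-- The Kronecker coefficient `g(p, q, r)`: the multiplicity of the irreducible module `S_r` in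
`S_p ⊗ S_q`, that is, the dimension of `Hom_{S_n}(S_r, S_p ⊗ S_q)`. -/
def kron {n : ℕ} (p q r : n.Partition) : ℕ :=
  Module.finrank ℂ
    (Representation.IntertwiningMap (specht r) ((specht p).tprod (specht q)))

/-! ### Symmetric functions

Symmetric functions are formal power series over `ℤ` in the variables `x_0, x_1, x_2, …`. -/

/-- The Kostka number `K_{p,d}`: the number of semistandard tableaux of shape `p` and type `d`
(entries are numbered from `0`). -/
def kostka (p : YoungDiagram) (d : ℕ →₀ ℕ) : ℕ :=
  Nat.card {T : SemistandardYoungTableau p //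
    ∀ i, (p.cells.filter (fun c => T c.1 c.2 = i)).card = d i}

/-- The Schur function `s_p`, the generating function of semistandard tableaux of shape `p`. -/
def schur (p : YoungDiagram) : MvPowerSeries ℕ ℤ := fun d => (kostka p d : ℤ)

/-- The monomial symmetric function `m_p`: the sum of all monomials whose nonzero exponents,
in some order, are the parts of `p`. -/
def monomialSymm {n : ℕ} (p : n.Partition) : MvPowerSeries ℕ ℤ := fun d =>
  if d.support.val.map d = p.parts then 1 else 0

open Classical in
/-- The coefficients of a symmetric function in the basis of Schur functions (and `0` for a power
series that is not a finite integer combination of Schur functions). -/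
def schurExpansion (f : MvPowerSeries ℕ ℤ) : YoungDiagram →₀ ℤ :=
  if h : ∃ c : YoungDiagram →₀ ℤ, Finsupp.linearCombination ℤ schur c = f then h.choose else 0

/-- The inner product on symmetric functions for which the Schur functions are orthonormal. -/
def hallInner (f g : MvPowerSeries ℕ ℤ) : ℤ :=
  (schurExpansion f).sum fun r z => z * schurExpansion g r

/-- The multi-Littlewood-Richardson coefficient
`c^p_{α^1 ⋯ α^k} = ⟨s_p, s_{α^1} ⋯ s_{α^k}⟩`, for `p ⊢ n` and `α^i ⊢ a_i`. -/
def multiLR {n : ℕ} (p : n.Partition) {k : ℕ} {a : Fin k → ℕ} (α : ∀ i, (a i).Partition) : ℤ :=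
  hallInner (schur (diagram p)) (∏ i, schur (diagram (α i)))

/-- The Kronecker product `s_p * s_q = ∑_{r ⊢ n} g(p, q, r) s_r`, for `p, q ⊢ n`. -/
def kronProd {n : ℕ} (p q : n.Partition) : MvPowerSeries ℕ ℤ :=
  ∑ r : n.Partition, (kron p q r : ℤ) • schur (diagram r)

/-! ### Monomials and the sets `P(μ; a)` -/

/-- The coefficient of `x^a = x_1^{a_1} ⋯ x_k^{a_k}` in the specialization `f(x_1, …, x_k)`, which
sets all other variables to `0`. -/
def monomialCoeff {k : ℕ} (a : Fin k → ℕ) (f : MvPowerSeries ℕ ℤ) : ℤ :=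
  MvPowerSeries.coeff (Finsupp.equivFunOnFinite.symm a)
    (MvPowerSeries.killCompl (Fin.valEmbedding : Fin k ↪ ℕ) f)

/-- `M_k(f)`: the exponent vectors of the monomials with positive coefficient in
`f(x_1, …, x_k)`. -/
def monomialSet (k : ℕ) (f : MvPowerSeries ℕ ℤ) : Set (Fin k → ℕ) :=
  {a | 0 < monomialCoeff a f}

/-- `P(p; a)`: the tuples `(α^1, …, α^k)` with `α^i ⊢ a_i` and `ℓ(α^i) ≤ ℓ(p)` (so that, padded by
zeros, they are vectors with `ℓ(p) k` entries) whose multi-LR coefficient `c^p_{α^1 ⋯ α^k}` is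
positive. -/
def lrSet {n : ℕ} (p : n.Partition) {k : ℕ} (a : Fin k → ℕ) : Set (∀ i, (a i).Partition) :=
  {α | (∀ i, (α i).parts.card ≤ p.parts.card) ∧ 0 < multiLR p α}

end KronMonomials

end

/-!
The coefficient of `x^a` in `s_μ * s_ν` is a multiplicity. By Young's rule the coefficient of `x^a`
in `s_r` is the pairing of the character `χ_r` of the Specht module with the character `π_a` of the
permutation module on the words of content `a`. Since the Specht characters form an orthonormal
basis of the class functions, the coefficient of `x^a` in `s_μ * s_ν` is
`∑_r ⟨χ_r, χ_μ χ_ν⟩ ⟨χ_r, π_a⟩ = ⟨χ_μ χ_ν, π_a⟩`. The module of words is induced from the trivial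
representation of the Young subgroup `S_a = S_{a_1} × ⋯ × S_{a_k}`, so that this number is the
pairing of the restrictions of `χ_μ` and `χ_ν` to `S_a` (`pairing_permChar_expo`), and Parseval's
identity on `S_a` (`sum_pairing_chiProd`) writes it as a sum over tuples `α`, in which
`χ_{α^1} ⊠ ⋯ ⊠ χ_{α^k}` contributes the product of its multiplicities in the two restrictions. These
multiplicities are the Littlewood-Richardson coefficients (`multiLR_eq_pairing`); in particular the
latter are nonnegative, and the statements on positive coefficients follow. The bound on the
lengths of the `α^i` holds because `s_{α^1} ⋯ s_{α^k}` contains the monomial of `μ`, which involves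
only the first `ℓ(μ)` variables.

Three ingredients are proved from the definitions.

* *The Specht modules are irreducible, pairwise non-isomorphic and exhaust the irreducible
  modules.* Where the usual argument uses the dominance order, the sum of the letters of a word, its
  weight, suffices: the column antisymmetrizer of a tableau `T` of shape `p` maps the words whose
  weight is at most that of `p` to multiples of the polytabloid of `T` (`colAntisymm_mem_span`).
  Completeness follows by counting cycle types (`eq_sum_chi`).
* *Young's rule* (`pairing_chi_permChar`). The numbers `⟨χ_r, π_b⟩` and the Kostka numbers are both
  unitriangular with respect to the weight. For both, the sum over `r` of the products of the entries
  at `a` and at `b` is the number of nonnegative integer matrices with row sums `a` and column sums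
  `b`. A unitriangular factor is determined by these sums. On the side of characters the count is
  the decomposition of a permutation module into orbits; on the side of tableaux it is the Cauchy
  identity, which follows from the Pieri rule (`schur_mul_homog`). The Pieri rule is proved by
  induction on the largest letter and reduces to the fact that adding and removing horizontal strips
  commute up to a local correction (`card_strip_commute`).
* *Littlewood-Richardson coefficients are restriction multiplicities.* Young's rule identifies the
  coefficients of `s_{α^1} ⋯ s_{α^k}` with the sums of `⟨χ_{α^1} ⊠ ⋯ ⊠ χ_{α^k}, χ_p⟩` against the
  Kostka numbers of `p`. Triangularity makes these pairings integers, and they are nonnegative because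
  a multiple of an irreducible character is an idempotent of the group algebra
  (`exists_prod_schur_eq`).
-/

noncomputable section

namespace KronMonomials

/-! ### Diagrams, contents and weights -/

theorem card_cellsOfRowLens (w : List ℕ) : (YoungDiagram.cellsOfRowLens w).card = w.sum := by
  induction w with
  | nil => rfl
  | cons m w ih =>
    rw [YoungDiagram.cellsOfRowLens, Finset.card_union_of_disjoint, Finset.card_map, ih]
    · simp
    · rw [Finset.disjoint_left]
      simp

theorem card_diagram {n : ℕ} (p : n.Partition) : (diagram p).cells.card = n := by
  have h := card_cellsOfRowLens (p.parts.sort (· ≥ ·))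
  rw [← Multiset.sum_coe, Multiset.sort_eq, p.parts_sum] at h
  exact h

theorem rowLens_diagram {n : ℕ} (p : n.Partition) :
    ((diagram p).rowLens : Multiset ℕ) = p.parts := by
  unfold diagram
  rw [YoungDiagram.rowLens_ofRowLens_eq_self, Multiset.sort_eq]
  intro x hx
  exact p.parts_pos ((Multiset.mem_sort _).1 hx)

theorem diagram_injective {n : ℕ} : Function.Injective (diagram (n := n)) := by
  intro p q h
  ext1
  rw [← rowLens_diagram, ← rowLens_diagram, h]

theorem exists_diagram_eq {n : ℕ} (r : YoungDiagram) (h : r.cells.card = n) :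
    ∃ p : n.Partition, diagram p = r := by
  have hd : ∀ (w : List ℕ) (hw : w.SortedGE) (m : Multiset ℕ), m = w →
      YoungDiagram.ofRowLens (m.sort (· ≥ ·)) (m.pairwise_sort (· ≥ ·)).sortedGE =
        YoungDiagram.ofRowLens w hw := by
    rintro w hw m rfl
    congr 1
    rw [Multiset.coe_sort]
    exact List.mergeSort_eq_self _ (by simpa using hw.pairwise)
  have h1 := hd r.rowLens r.rowLens_sorted r.rowLens rfl
  rw [YoungDiagram.ofRowLens_to_rowLens_eq_self] at h1
  have h2 : (r.rowLens : Multiset ℕ).sum = n := by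
    rw [Multiset.sum_coe, ← card_cellsOfRowLens, ← h]
    exact congrArg (fun y : YoungDiagram => y.cells.card) r.ofRowLens_to_rowLens_eq_self
  exact ⟨⟨r.rowLens, fun {i} hi => r.pos_of_mem_rowLens i (by simpa using hi), h2⟩, h1⟩

/-- The content of a word: the multiplicity of each letter. -/
def content {E : Type*} [Fintype E] (w : E → ℕ) : ℕ →₀ ℕ := ∑ e, Finsupp.single (w e) 1

theorem content_apply {E : Type*} [Fintype E] (w : E → ℕ) (i : ℕ) :
    content w i = (Finset.univ.filter fun e => w e = i).card := by
  simp [content, Finsupp.finsetSum_apply, Finsupp.single_apply]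

theorem content_comp_equiv {E F : Type*} [Fintype E] [Fintype F] (σ : E ≃ F) (w : F → ℕ) :
    content (w ∘ σ) = content w :=
  Equiv.sum_comp σ fun e => Finsupp.single (w e) 1

theorem degree_content {E : Type*} [Fintype E] (w : E → ℕ) :
    (content w).degree = Fintype.card E := by
  simp [content, map_sum]

/-- The sum of the letters of a word of content `d`. It takes the place of the dominance order: the
contents that dominate a given one have smaller weight. -/
def weight (d : ℕ →₀ ℕ) : ℕ := d.sum fun i m => m * i

theorem weight_add (d d' : ℕ →₀ ℕ) : weight (d + d') = weight d + weight d' :=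
  Finsupp.sum_add_index' (by simp) (by intros; ring)

theorem weight_content {E : Type*} [Fintype E] (w : E → ℕ) : weight (content w) = ∑ e, w e := by
  have h : ∀ s : Finset E, weight (∑ e ∈ s, Finsupp.single (w e) 1) = ∑ e ∈ s, w e := by
    classical
    intro s
    induction s using Finset.induction_on with
    | empty => simp [weight]
    | insert a s ha ih =>
      rw [Finset.sum_insert ha, Finset.sum_insert ha, weight_add, ih]
      simp [weight]
  exact h _

/-- The row lengths of a diagram, as a content: the multiplicities of the tableau whose `i`-th row
is filled with the letter `i`. -/
def rowContent (r : YoungDiagram) : ℕ →₀ ℕ := ∑ c ∈ r.cells, Finsupp.single c.1 1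

theorem rowContent_apply (r : YoungDiagram) (i : ℕ) : rowContent r i = r.rowLen i := by
  rw [YoungDiagram.rowLen_eq_card, YoungDiagram.row, Finset.card_filter]
  simp [rowContent, Finsupp.finsetSum_apply, Finsupp.single_apply]

theorem rowContent_injective : Function.Injective rowContent := by
  intro r s h
  ext ⟨i, j⟩
  rw [YoungDiagram.mem_cells, YoungDiagram.mem_cells, YoungDiagram.mem_iff_lt_rowLen,
    YoungDiagram.mem_iff_lt_rowLen, ← rowContent_apply, ← rowContent_apply, h]

theorem content_rowOf {n : ℕ} {p : n.Partition} (T : Tableau p) :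
    content (rowOf T) = rowContent (diagram p) := by
  rw [content, rowContent, ← Finset.sum_coe_sort (diagram p).cells]
  exact Equiv.sum_comp T fun c => Finsupp.single c.1.1 1

theorem degree_rowContent (r : YoungDiagram) : (rowContent r).degree = r.cells.card := by
  simp [rowContent, map_sum]

theorem weight_rowContent (r : YoungDiagram) : weight (rowContent r) = ∑ c ∈ r.cells, c.1 := by
  have h := weight_content fun c : r.cells => c.1.1
  rw [Finset.sum_coe_sort r.cells fun c => c.1] at h
  rw [← h, content, Finset.sum_coe_sort r.cells fun c => Finsupp.single c.1 1]
  rfl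

instance {n : ℕ} (p : n.Partition) : Nonempty (Tableau p) :=
  ⟨Fintype.equivOfCardEq (by simp [card_diagram])⟩

/-! ### Column antisymmetrizers -/

theorem mem_colStab {n : ℕ} {p : n.Partition} {T : Tableau p} {σ : Equiv.Perm (Fin n)} :
    σ ∈ colStab T ↔ ∀ e, colOf T (σ e) = colOf T e := by
  simp [colStab]

theorem wordRep_single {n : ℕ} (σ : Equiv.Perm (Fin n)) (w : Fin n → ℕ) (c : ℂ) :
    wordRep n σ (Finsupp.single w c) = Finsupp.single (w ∘ ⇑σ⁻¹) c := by
  simp only [wordRep, MonoidHom.coe_mk, OneHom.coe_mk, Finsupp.lmapDomain_apply,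
    Finsupp.mapDomain_single]
  rfl

/-- The column antisymmetrizer `κ_T = ∑_{σ ∈ C_T} sgn(σ) σ`, acting on words. -/
def colAntisymm {n : ℕ} {p : n.Partition} (T : Tableau p) :
    ((Fin n → ℕ) →₀ ℂ) →ₗ[ℂ] ((Fin n → ℕ) →₀ ℂ) :=
  ∑ σ ∈ colStab T, ((Equiv.Perm.sign σ : ℤ) : ℂ) • wordRep n σ

theorem colAntisymm_apply {n : ℕ} {p : n.Partition} (T : Tableau p) (v : (Fin n → ℕ) →₀ ℂ) :
    colAntisymm T v = ∑ σ ∈ colStab T, ((Equiv.Perm.sign σ : ℤ) : ℂ) • wordRep n σ v := by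
  simp [colAntisymm]

theorem polytabloid_eq {n : ℕ} {p : n.Partition} (T : Tableau p) :
    polytabloid T = colAntisymm T (Finsupp.single (rowOf T) 1) :=
  (colAntisymm_apply _ _).symm

theorem sign_mul_self {n : ℕ} (τ : Equiv.Perm (Fin n)) :
    ((Equiv.Perm.sign τ : ℤ) : ℂ) * ((Equiv.Perm.sign τ : ℤ) : ℂ) = 1 := by
  rcases Int.units_eq_one_or (Equiv.Perm.sign τ) with h | h <;> simp [h]

theorem colAntisymm_wordRep {n : ℕ} {p : n.Partition} (T : Tableau p) {τ : Equiv.Perm (Fin n)}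
    (hτ : τ ∈ colStab T) (v : (Fin n → ℕ) →₀ ℂ) :
    colAntisymm T (wordRep n τ v) = ((Equiv.Perm.sign τ : ℤ) : ℂ) • colAntisymm T v := by
  rw [mem_colStab] at hτ
  rw [colAntisymm_apply, colAntisymm_apply, Finset.smul_sum]
  refine Finset.sum_bij' (fun σ _ => σ * τ) (fun σ _ => σ * τ⁻¹) ?_ ?_ ?_ ?_ ?_
  · intro σ hσ
    rw [mem_colStab] at hσ ⊢
    intro e
    rw [Equiv.Perm.mul_apply, hσ, hτ]
  · intro σ hσ
    rw [mem_colStab] at hσ ⊢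
    intro e
    rw [Equiv.Perm.mul_apply, hσ]
    simpa using (hτ (τ⁻¹ e)).symm
  · intro σ _
    group
  · intro σ _
    group
  · intro σ _
    rw [smul_smul, map_mul, map_mul, Units.val_mul, Int.cast_mul, mul_left_comm, sign_mul_self,
      mul_one, Module.End.mul_apply]

theorem colAntisymm_colAntisymm {n : ℕ} {p : n.Partition} (T : Tableau p)
    (v : (Fin n → ℕ) →₀ ℂ) :
    colAntisymm T (colAntisymm T v) = ((colStab T).card : ℂ) • colAntisymm T v := by
  conv_lhs => rw [colAntisymm_apply T v, map_sum]
  rw [Finset.sum_congr rfl fun σ hσ => by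
    rw [map_smul, colAntisymm_wordRep T hσ, smul_smul, sign_mul_self, one_smul]]
  rw [Finset.sum_const, Nat.cast_smul_eq_nsmul]

theorem colAntisymm_single_eq_zero {n : ℕ} {p : n.Partition} (T : Tableau p) {w : Fin n → ℕ}
    {e e' : Fin n} (hne : e ≠ e') (hcol : colOf T e = colOf T e') (hw : w e = w e') :
    colAntisymm T (Finsupp.single w 1) = 0 := by
  have hmem : Equiv.swap e e' ∈ colStab T := by
    rw [mem_colStab]
    intro x
    by_cases h1 : x = e
    · subst h1; simp [hcol]
    by_cases h2 : x = e'
    · subst h2; simp [hcol]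
    rw [Equiv.swap_apply_of_ne_of_ne h1 h2]
  have h := colAntisymm_wordRep T hmem (Finsupp.single w 1)
  have hfix : w ∘ ⇑(Equiv.swap e e')⁻¹ = w := by
    funext x
    rw [Equiv.swap_inv, Function.comp_apply]
    by_cases h1 : x = e
    · subst h1; simp [hw]
    by_cases h2 : x = e'
    · subst h2; simp [hw]
    rw [Equiv.swap_apply_of_ne_of_ne h1 h2]
  rw [wordRep_single, hfix, Equiv.Perm.sign_swap hne] at h
  simpa [self_eq_neg] using h

/-- Among all sets of `m` natural numbers, the first `m` natural numbers are the only one with the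
smallest sum. -/
theorem sum_range_card_le (s : Finset ℕ) :
    ∑ i ∈ Finset.range s.card, i ≤ ∑ i ∈ s, i ∧
      (∑ i ∈ s, i ≤ ∑ i ∈ Finset.range s.card, i → s = Finset.range s.card) := by
  induction s using Finset.induction_on_max with
  | empty => simp
  | insert m s hm ih =>
    have hms : m ∉ s := fun h => (hm m h).false
    have hle : s.card ≤ m := by
      have : s ⊆ Finset.range m := fun x hx => Finset.mem_range.2 (hm x hx)
      simpa using Finset.card_le_card this
    rw [Finset.card_insert_of_notMem hms, Finset.sum_insert hms, Finset.sum_range_succ]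
    refine ⟨by omega, fun h => ?_⟩
    have h1 : m = s.card := by omega
    rw [Finset.range_add_one, ← ih.2 (by omega), ← h1]

/-- The numerical form of the dominance argument: a word without repeated letters in the columns
of `T` has at least the weight of the word of row indices, and if its weight is not larger, it
arises from the word of row indices by permuting the columns. -/
theorem exists_colStab_of_sum_le {n : ℕ} {p : n.Partition} (T : Tableau p) (w : Fin n → ℕ)
    (hinj : ∀ e e', colOf T e = colOf T e' → w e = w e' → e = e')
    (hsum : ∑ e, w e ≤ ∑ e, rowOf T e) : ∃ σ ∈ colStab T, w = rowOf T ∘ σ := by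
  classical
  set F : ℕ → Finset (Fin n) := fun j => Finset.univ.filter fun e => colOf T e = j with hF
  have hrow : ∀ j, (F j).image (rowOf T) = Finset.range ((diagram p).colLen j) := by
    intro j
    ext i
    simp only [hF, Finset.mem_image, Finset.mem_filter, Finset.mem_univ, true_and,
      Finset.mem_range]
    rw [← YoungDiagram.mem_iff_lt_colLen, ← YoungDiagram.mem_cells]
    constructor
    · rintro ⟨e, rfl, rfl⟩
      exact (T e).2
    · intro h
      exact ⟨T.symm ⟨(i, j), h⟩, by simp [colOf], by simp [rowOf]⟩
  have hrowinj : ∀ j, Set.InjOn (rowOf T) (F j) := by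
    intro j e he e' he' h
    simp only [hF, Finset.coe_filter, Finset.mem_univ, true_and, Set.mem_ofPred_eq] at he he'
    exact T.injective (Subtype.ext (Prod.ext h (he.trans he'.symm)))
  have hwinj : ∀ j, Set.InjOn w (F j) := by
    intro j e he e' he' h
    simp only [hF, Finset.coe_filter, Finset.mem_univ, true_and, Set.mem_ofPred_eq] at he he'
    exact hinj e e' (he.trans he'.symm) h
  have hcard : ∀ j, ((F j).image w).card = (diagram p).colLen j := by
    intro j
    rw [Finset.card_image_of_injOn (hwinj j), ← Finset.card_image_of_injOn (hrowinj j), hrow,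
      Finset.card_range]
  have hwsum : ∀ j, ∑ e ∈ F j, w e = ∑ i ∈ (F j).image w, i :=
    fun j => (Finset.sum_image (f := fun i => i) (hwinj j)).symm
  have hrsum : ∀ j, ∑ e ∈ F j, rowOf T e = ∑ i ∈ Finset.range ((diagram p).colLen j), i :=
    fun j => by rw [← hrow, Finset.sum_image (f := fun i => i) (hrowinj j)]
  have hle : ∀ j, ∑ e ∈ F j, rowOf T e ≤ ∑ e ∈ F j, w e := by
    intro j
    rw [hwsum, hrsum, ← hcard j]
    exact (sum_range_card_le _).1
  have hfib : ∀ f : Fin n → ℕ, ∑ e, f e = ∑ j ∈ Finset.univ.image (colOf T), ∑ e ∈ F j, f e :=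
    fun f => (Finset.sum_fiberwise_of_maps_to
      (fun e _ => Finset.mem_image_of_mem _ (Finset.mem_univ e)) f).symm
  have heq : ∀ e, w e < (diagram p).colLen (colOf T e) := by
    intro e
    have hj : colOf T e ∈ Finset.univ.image (colOf T) :=
      Finset.mem_image_of_mem _ (Finset.mem_univ e)
    have hall := (Finset.sum_eq_sum_iff_of_le fun j (_ : j ∈ Finset.univ.image (colOf T)) =>
      hle j).1 (le_antisymm (Finset.sum_le_sum fun j _ => hle j)
        (by rw [← hfib, ← hfib]; exact hsum)) _ hj
    rw [hwsum, hrsum, ← hcard] at hall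
    have himg := (sum_range_card_le _).2 hall.ge
    rw [hcard] at himg
    rw [← Finset.mem_range, ← himg]
    exact Finset.mem_image_of_mem _ (by simp [hF])
  have hcell : ∀ e, (w e, colOf T e) ∈ (diagram p).cells := fun e => by
    rw [YoungDiagram.mem_cells, YoungDiagram.mem_iff_lt_colLen]
    exact heq e
  set s : Fin n → Fin n := fun e => T.symm ⟨(w e, colOf T e), hcell e⟩ with hs
  have hsinj : Function.Injective s := by
    intro e e' h
    have h' := T.symm.injective h
    rw [Subtype.mk.injEq, Prod.mk.injEq] at h'
    exact hinj e e' h'.2 h'.1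
  refine ⟨Equiv.ofBijective s (Finite.injective_iff_bijective.1 hsinj), ?_, ?_⟩
  · rw [mem_colStab]
    intro e
    simp [colOf, hs]
  · funext e
    simp [rowOf, hs]

theorem colAntisymm_single_of_sum_le {n : ℕ} {p : n.Partition} (T : Tableau p) (w : Fin n → ℕ)
    (hsum : ∑ e, w e ≤ ∑ e, rowOf T e) :
    ∃ c : ℂ, colAntisymm T (Finsupp.single w 1) = c • polytabloid T := by
  by_cases hinj : ∀ e e', colOf T e = colOf T e' → w e = w e' → e = e'
  · obtain ⟨σ, hσ, rfl⟩ := exists_colStab_of_sum_le T w hinj hsum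
    have hσ' : σ⁻¹ ∈ colStab T := by
      rw [mem_colStab] at hσ ⊢
      intro e
      simpa using (hσ (σ⁻¹ e)).symm
    have h := colAntisymm_wordRep T hσ' (Finsupp.single (rowOf T) 1)
    rw [wordRep_single, inv_inv] at h
    exact ⟨_, h.trans (by rw [polytabloid_eq])⟩
  · push Not at hinj
    obtain ⟨e, e', hcol, hw, hne⟩ := hinj
    exact ⟨0, by rw [colAntisymm_single_eq_zero T hne hcol hw, zero_smul]⟩

/-- The column antisymmetrizer of `T` maps all words whose weight is at most that of the shape into
the line spanned by the polytabloid of `T`. -/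
theorem colAntisymm_mem_span {n : ℕ} {p : n.Partition} (T : Tableau p) (v : (Fin n → ℕ) →₀ ℂ)
    (hv : v ∈ Finsupp.supported ℂ ℂ {w : Fin n → ℕ | ∑ e, w e ≤ weight (rowContent (diagram p))}) :
    ∃ c : ℂ, colAntisymm T v = c • polytabloid T := by
  have hT : ∑ e, rowOf T e = weight (rowContent (diagram p)) := by
    rw [← content_rowOf T, weight_content]
  suffices h : v ∈ (Submodule.span ℂ {polytabloid T}).comap (colAntisymm T) by
    obtain ⟨c, hc⟩ := Submodule.mem_span_singleton.1 (Submodule.mem_comap.1 h)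
    exact ⟨c, hc.symm⟩
  rw [Finsupp.supported_eq_span_single] at hv
  refine Submodule.span_le.2 ?_ hv
  rintro _ ⟨w, hw, rfl⟩
  obtain ⟨c, hc⟩ := colAntisymm_single_of_sum_le T w (by rw [hT]; exact hw)
  exact Submodule.mem_comap.2 (hc ▸ Submodule.smul_mem _ _ (Submodule.mem_span_singleton_self _))

theorem polytabloid_apply_rowOf {n : ℕ} {p : n.Partition} (T : Tableau p) :
    polytabloid T (rowOf T) = 1 := by
  have h1 : (1 : Equiv.Perm (Fin n)) ∈ colStab T := by simp [mem_colStab]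
  rw [polytabloid, Finsupp.finsetSum_apply, Finset.sum_eq_single_of_mem _ h1]
  · simp
  · intro σ hσ hne
    rw [wordRep_single, Finsupp.smul_apply, Finsupp.single_eq_of_ne, smul_zero]
    intro h
    apply hne
    rw [mem_colStab] at hσ
    ext1 e
    have hr : rowOf T (σ e) = rowOf T e := by
      rw [congrFun h (σ e)]
      simp
    exact T.injective (Subtype.ext (Prod.ext hr (hσ e)))

theorem polytabloid_ne_zero {n : ℕ} {p : n.Partition} (T : Tableau p) : polytabloid T ≠ 0 := by
  intro h
  have := polytabloid_apply_rowOf T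
  simp [h] at this

theorem card_colStab_ne_zero {n : ℕ} {p : n.Partition} (T : Tableau p) :
    ((colStab T).card : ℂ) ≠ 0 := by
  have h1 : (1 : Equiv.Perm (Fin n)) ∈ colStab T := by simp [mem_colStab]
  exact Nat.cast_ne_zero.2 (Finset.card_ne_zero_of_mem h1)

theorem polytabloid_mem {n : ℕ} {p : n.Partition} (T : Tableau p) :
    polytabloid T ∈ (spechtSub p).toSubmodule :=
  Submodule.subset_span ⟨T, rfl⟩

/-! ### Homomorphisms out of Specht modules -/

/-- The span of the words of content `d`: the permutation module `M^d`. -/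
def permSub (n : ℕ) (d : ℕ →₀ ℕ) : Subrepresentation (wordRep n) where
  toSubmodule := Finsupp.supported ℂ ℂ {w | content w = d}
  apply_mem_toSubmodule σ v hv := by
    rw [Finsupp.supported_eq_span_single] at hv ⊢
    have h := Submodule.mem_map_of_mem (f := wordRep n σ) hv
    rw [Submodule.map_span] at h
    refine Submodule.span_mono ?_ h
    rintro _ ⟨_, ⟨w, hw, rfl⟩, rfl⟩
    refine ⟨w ∘ ⇑σ⁻¹, ?_, (wordRep_single _ _ _).symm⟩
    exact (content_comp_equiv σ⁻¹ w).trans hw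

theorem spechtSub_le_permSub {n : ℕ} (p : n.Partition) :
    (spechtSub p).toSubmodule ≤ (permSub n (rowContent (diagram p))).toSubmodule := by
  refine Submodule.span_le.2 ?_
  rintro _ ⟨T, rfl⟩
  refine Submodule.sum_mem _ fun σ _ => Submodule.smul_mem _ _ ?_
  apply (permSub n _).apply_mem_toSubmodule
  exact Finsupp.single_mem_supported ℂ 1 (content_rowOf T)

theorem permSub_le {n : ℕ} (d : ℕ →₀ ℕ) (m : ℕ) (hd : weight d ≤ m) :
    (permSub n d).toSubmodule ≤ Finsupp.supported ℂ ℂ {w : Fin n → ℕ | ∑ e, w e ≤ m} := by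
  refine Finsupp.supported_mono ?_
  rintro w rfl
  rw [weight_content] at hd
  exact hd

/-- An intertwining map from a Specht module `S_p` into a space of words of weight at most that
of `p` is a multiple of the inclusion. -/
theorem exists_smul_of_intertwining {n : ℕ} {p : n.Partition} {X : Subrepresentation (wordRep n)}
    (hX : X.toSubmodule ≤
      Finsupp.supported ℂ ℂ {w : Fin n → ℕ | ∑ e, w e ≤ weight (rowContent (diagram p))})
    (θ : Representation.IntertwiningMap (specht p) X.toRepresentation) :
    ∃ c : ℂ, ∀ v, (θ v : (Fin n → ℕ) →₀ ℂ) = c • (v : (Fin n → ℕ) →₀ ℂ) := by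
  obtain ⟨T⟩ : Nonempty (Tableau p) := inferInstance
  have hint : ∀ (σ : Equiv.Perm (Fin n)) v,
      (θ (specht p σ v) : (Fin n → ℕ) →₀ ℂ) = wordRep n σ (θ v) := by
    intro σ v
    rw [θ.isIntertwining]
    rfl
  set eT : (spechtSub p).toSubmodule := ⟨polytabloid T, polytabloid_mem T⟩ with heT
  -- `θ` commutes with the column antisymmetrizer
  have hκ : ∀ v : (spechtSub p).toSubmodule, ∀ u : (spechtSub p).toSubmodule,
      (u : (Fin n → ℕ) →₀ ℂ) = colAntisymm T v →
      (θ u : (Fin n → ℕ) →₀ ℂ) = colAntisymm T (θ v) := by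
    intro v u hu
    have : u = ∑ σ ∈ colStab T, ((Equiv.Perm.sign σ : ℤ) : ℂ) • specht p σ v := by
      apply Subtype.ext
      rw [hu, colAntisymm_apply, Submodule.coe_sum]
      rfl
    rw [this, map_sum, Submodule.coe_sum, colAntisymm_apply]
    refine Finset.sum_congr rfl fun σ _ => ?_
    rw [map_smul, Submodule.coe_smul, hint]
  obtain ⟨c, hc⟩ := colAntisymm_mem_span T (θ eT) (hX (θ eT).2)
  -- `κ_T e_T = |C_T| e_T`, so that `θ e_T` is a multiple of `κ_T (θ e_T)`
  have h1 := hκ eT (((colStab T).card : ℂ) • eT) (by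
    rw [Submodule.coe_smul, heT]
    simp only
    rw [polytabloid_eq, colAntisymm_colAntisymm])
  rw [map_smul, Submodule.coe_smul, hc] at h1
  have h2 : (θ eT : (Fin n → ℕ) →₀ ℂ) = (((colStab T).card : ℂ)⁻¹ * c) • polytabloid T := by
    rw [mul_smul, ← h1, smul_smul, inv_mul_cancel₀ (card_colStab_ne_zero T), one_smul]
  refine ⟨((colStab T).card : ℂ)⁻¹ * c, ?_⟩
  set a := ((colStab T).card : ℂ)⁻¹ * c
  have hlin : X.toSubmodule.subtype ∘ₗ θ.toLinearMap = a • (spechtSub p).toSubmodule.subtype := by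
    refine LinearMap.ext_on_range
      (v := fun S : Tableau p => (⟨polytabloid S, polytabloid_mem S⟩ : (spechtSub p).toSubmodule))
      ?_ ?_
    · exact Submodule.span_range_subtype_eq_top_iff _ (fun S => polytabloid_mem S) |>.2 rfl
    · intro S
      -- every polytabloid of shape `p` is a translate of `e_T`
      have hS : (⟨polytabloid S, polytabloid_mem S⟩ : (spechtSub p).toSubmodule) =
          specht p (T.trans S.symm) eT := by
        apply Subtype.ext
        change _ = wordRep n (T.trans S.symm) (polytabloid T)
        rw [wordRep_polytabloid]
        refine congrArg polytabloid ?_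
        ext1 e
        simp
      have h3 := hint (T.trans S.symm) eT
      rw [h2, map_smul] at h3
      rw [hS]
      exact h3
  intro v
  exact LinearMap.congr_fun hlin v

instance {n : ℕ} (p : n.Partition) : FiniteDimensional ℂ (spechtSub p).toSubmodule :=
  FiniteDimensional.span_of_finite ℂ (Set.finite_range _)

/-- A space of words of weight at most that of `p` that contains `S_p` contains it exactly once. -/
theorem finrank_hom_eq_one {n : ℕ} {p : n.Partition} {X : Subrepresentation (wordRep n)}
    (hX : X.toSubmodule ≤
      Finsupp.supported ℂ ℂ {w : Fin n → ℕ | ∑ e, w e ≤ weight (rowContent (diagram p))})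
    (hp : (spechtSub p).toSubmodule ≤ X.toSubmodule) :
    Module.finrank ℂ (Representation.IntertwiningMap (specht p) X.toRepresentation) = 1 := by
  obtain ⟨T⟩ : Nonempty (Tableau p) := inferInstance
  let ι : Representation.IntertwiningMap (specht p) X.toRepresentation :=
    { Submodule.inclusion hp with isIntertwining' := fun g => rfl }
  have hbij : Function.Bijective (LinearMap.toSpanSingleton ℂ _ ι) := by
    constructor
    · intro c c' h
      have h1 := congrArg (fun θ : Representation.IntertwiningMap (specht p) X.toRepresentation =>
        (θ ⟨polytabloid T, polytabloid_mem T⟩ : (Fin n → ℕ) →₀ ℂ)) h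
      exact smul_left_injective ℂ (polytabloid_ne_zero T) h1
    · intro θ
      obtain ⟨c, hc⟩ := exists_smul_of_intertwining hX θ
      refine ⟨c, ?_⟩
      apply Representation.IntertwiningMap.ext
      refine LinearMap.ext fun v => Subtype.ext ?_
      exact (hc v).symm
  rw [← (LinearEquiv.ofBijective _ hbij).finrank_eq, Module.finrank_self]

/-- A space of words of weight at most that of `p` that contains no polytabloid of shape `p` does
not contain `S_p`. -/
theorem finrank_hom_eq_zero {n : ℕ} {p : n.Partition} {X : Subrepresentation (wordRep n)}
    (hX : X.toSubmodule ≤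
      Finsupp.supported ℂ ℂ {w : Fin n → ℕ | ∑ e, w e ≤ weight (rowContent (diagram p))})
    (hp : ∀ T : Tableau p, polytabloid T ∉ X.toSubmodule) :
    Module.finrank ℂ (Representation.IntertwiningMap (specht p) X.toRepresentation) = 0 := by
  obtain ⟨T⟩ : Nonempty (Tableau p) := inferInstance
  have : Subsingleton (Representation.IntertwiningMap (specht p) X.toRepresentation) := by
    refine subsingleton_of_forall_eq 0 fun θ => ?_
    obtain ⟨c, hc⟩ := exists_smul_of_intertwining hX θ
    have hc0 : c = 0 := by
      by_contra hne
      apply hp T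
      have h := hc ⟨polytabloid T, polytabloid_mem T⟩
      rw [← inv_smul_smul₀ hne (polytabloid T)]
      exact Submodule.smul_mem _ _ (h ▸ (θ _).2)
    apply Representation.IntertwiningMap.ext
    refine LinearMap.ext fun v => Subtype.ext ?_
    refine (hc v).trans ?_
    rw [hc0, zero_smul]
    rfl
  exact Module.finrank_zero_of_subsingleton

theorem polytabloid_notMem_permSub {n : ℕ} {p : n.Partition} (T : Tableau p) {d : ℕ →₀ ℕ}
    (hd : d ≠ rowContent (diagram p)) : polytabloid T ∉ (permSub n d).toSubmodule := by
  intro h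
  have h1 := (Finsupp.mem_supported _ _).1 h (show rowOf T ∈ _ by
    simp [polytabloid_apply_rowOf])
  exact hd (h1.symm.trans (content_rowOf T))

/-! ### Characters -/

/-- The normalized bilinear pairing of functions on a finite group. Characters of symmetric groups
are real, so that no complex conjugation is needed. -/
def pairing {G : Type*} [Fintype G] (f g : G → ℂ) : ℂ :=
  (Fintype.card G : ℂ)⁻¹ * ∑ x, f x * g x

theorem pairing_comm {G : Type*} [Fintype G] (f g : G → ℂ) : pairing f g = pairing g f := by
  simp only [pairing, mul_comm]

theorem pairing_sum_right {G ι : Type*} [Fintype G] (s : Finset ι) (f : G → ℂ) (c : ι → ℂ)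
    (g : ι → G → ℂ) :
    pairing f (fun x => ∑ i ∈ s, c i * g i x) = ∑ i ∈ s, c i * pairing f (g i) := by
  simp only [pairing, Finset.mul_sum]
  rw [Finset.sum_comm]
  refine Finset.sum_congr rfl fun i _ => Finset.sum_congr rfl fun x _ => ?_
  ring

/-- The character of the Specht module `S_p`. -/
def chi {n : ℕ} (p : n.Partition) (σ : Equiv.Perm (Fin n)) : ℂ :=
  LinearMap.trace ℂ _ (specht p σ)

section Subrepresentation

variable {G V : Type*} [Group G] [AddCommGroup V] [Module ℂ V] {ρ : Representation ℂ G V}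

theorem trace_subrepresentation_conj (A : Subrepresentation ρ) (g h : G) :
    LinearMap.trace ℂ _ (A.toRepresentation (h * g * h⁻¹)) =
      LinearMap.trace ℂ _ (A.toRepresentation g) :=
  Representation.char_conj A.toRepresentation g h

theorem trace_subrepresentation_one (A : Subrepresentation ρ)
    [FiniteDimensional ℂ A.toSubmodule] :
    LinearMap.trace ℂ _ (A.toRepresentation 1) = Module.finrank ℂ A.toSubmodule :=
  Representation.char_one A.toRepresentation

theorem card_inv_mul_sum_trace [Fintype G] (A B : Subrepresentation ρ)
    [FiniteDimensional ℂ A.toSubmodule] [FiniteDimensional ℂ B.toSubmodule] :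
    (Fintype.card G : ℂ)⁻¹ * ∑ g, LinearMap.trace ℂ _ (B.toRepresentation g) *
      LinearMap.trace ℂ _ (A.toRepresentation g⁻¹) =
      Module.finrank ℂ (Representation.IntertwiningMap A.toRepresentation B.toRepresentation) := by
  have : Invertible (Nat.card G : ℂ) := invertibleOfNonzero (by simp)
  rw [← Representation.card_inv_mul_sum_char_mul_char_eq_finrank, Nat.card_eq_fintype_card]
  rfl

theorem card_inv_mul_sum_trace_tprod [Fintype G] (A B C : Subrepresentation ρ)
    [FiniteDimensional ℂ A.toSubmodule] [FiniteDimensional ℂ B.toSubmodule]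
    [FiniteDimensional ℂ C.toSubmodule] :
    (Fintype.card G : ℂ)⁻¹ * ∑ g, LinearMap.trace ℂ _ (A.toRepresentation g) *
      LinearMap.trace ℂ _ (B.toRepresentation g) * LinearMap.trace ℂ _ (C.toRepresentation g⁻¹) =
      Module.finrank ℂ (Representation.IntertwiningMap C.toRepresentation
        (A.toRepresentation.tprod B.toRepresentation)) := by
  have : Invertible (Nat.card G : ℂ) := invertibleOfNonzero (by simp)
  rw [← Representation.card_inv_mul_sum_char_mul_char_eq_finrank, Nat.card_eq_fintype_card,
    Representation.char_tensor]
  rfl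

end Subrepresentation

theorem chi_conj {n : ℕ} (p : n.Partition) (g h : Equiv.Perm (Fin n)) :
    chi p (h * g * h⁻¹) = chi p g :=
  trace_subrepresentation_conj (spechtSub p) g h

theorem chi_inv {n : ℕ} (p : n.Partition) (σ : Equiv.Perm (Fin n)) : chi p σ⁻¹ = chi p σ := by
  have h : IsConj σ σ⁻¹ := Equiv.Perm.isConj_iff_cycleType_eq.2 σ.cycleType_inv.symm
  obtain ⟨c, hc⟩ := isConj_iff.1 h
  rw [← hc, chi_conj]

theorem pairing_chi_tensor {n : ℕ} (p q r : n.Partition) :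
    pairing (chi r) (fun σ => chi p σ * chi q σ) = kron p q r := by
  have h := card_inv_mul_sum_trace_tprod (spechtSub p) (spechtSub q) (spechtSub r)
  refine Eq.trans ?_ h
  refine congrArg _ (Finset.sum_congr rfl fun σ _ => ?_)
  rw [mul_comm, ← chi_inv r]
  rfl

theorem pairing_chi_chi_eq_finrank {n : ℕ} (p q : n.Partition) :
    pairing (chi p) (chi q) =
      Module.finrank ℂ (Representation.IntertwiningMap (specht p) (specht q)) := by
  have h : (Fintype.card (Equiv.Perm (Fin n)) : ℂ)⁻¹ * ∑ g, chi q g * chi p g⁻¹ =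
      Module.finrank ℂ (Representation.IntertwiningMap (specht p) (specht q)) :=
    card_inv_mul_sum_trace (spechtSub p) (spechtSub q)
  rw [← h, pairing]
  refine congrArg _ (Finset.sum_congr rfl fun σ _ => ?_)
  rw [mul_comm, chi_inv p]

theorem spechtSub_le_supported {n : ℕ} (p : n.Partition) {m : ℕ}
    (h : weight (rowContent (diagram p)) ≤ m) :
    (spechtSub p).toSubmodule ≤ Finsupp.supported ℂ ℂ {w : Fin n → ℕ | ∑ e, w e ≤ m} :=
  (spechtSub_le_permSub p).trans (permSub_le _ _ h)

theorem pairing_chi_self {n : ℕ} (p : n.Partition) : pairing (chi p) (chi p) = 1 := by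
  rw [pairing_chi_chi_eq_finrank]
  have h := finrank_hom_eq_one (spechtSub_le_supported p le_rfl) le_rfl
  exact_mod_cast congrArg (Nat.cast (R := ℂ)) h

theorem pairing_chi_ne {n : ℕ} {p q : n.Partition} (hpq : p ≠ q) :
    pairing (chi p) (chi q) = 0 := by
  wlog hw : weight (rowContent (diagram q)) ≤ weight (rowContent (diagram p)) generalizing p q
  · rw [pairing_comm]
    exact this hpq.symm (le_of_not_ge hw)
  rw [pairing_chi_chi_eq_finrank]
  have h := finrank_hom_eq_zero (spechtSub_le_supported q hw) fun T hT =>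
    polytabloid_notMem_permSub T
      (fun h => hpq (diagram_injective (rowContent_injective h)).symm) (spechtSub_le_permSub q hT)
  exact_mod_cast congrArg (Nat.cast (R := ℂ)) h

theorem pairing_chi_chi {n : ℕ} (p q : n.Partition) :
    pairing (chi p) (chi q) = if p = q then 1 else 0 := by
  split_ifs with h
  · rw [h, pairing_chi_self]
  · exact pairing_chi_ne h

/-! ### Permutation characters -/

/-- The words of content `d`. -/
def words (E : Type*) [Fintype E] [DecidableEq E] (d : ℕ →₀ ℕ) : Finset (E → ℕ) :=
  (Fintype.piFinset fun _ => d.support).filter fun w => content w = d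

theorem mem_words {E : Type*} [Fintype E] [DecidableEq E] {d : ℕ →₀ ℕ} {w : E → ℕ} :
    w ∈ words E d ↔ content w = d := by
  rw [words, Finset.mem_filter, Fintype.mem_piFinset, and_iff_right_iff_imp]
  rintro rfl e
  rw [Finsupp.mem_support_iff, content_apply]
  exact Finset.card_ne_zero_of_mem (Finset.mem_filter.2 ⟨Finset.mem_univ e, rfl⟩)

/-- The words of content `d` that are fixed by `σ`. -/
def fixedWords {E : Type*} [Fintype E] [DecidableEq E] (d : ℕ →₀ ℕ) (σ : Equiv.Perm E) :
    Finset (E → ℕ) :=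
  (words E d).filter fun w => w ∘ σ = w

theorem mem_fixedWords {E : Type*} [Fintype E] [DecidableEq E] {d : ℕ →₀ ℕ} {σ : Equiv.Perm E}
    {w : E → ℕ} : w ∈ fixedWords d σ ↔ content w = d ∧ w ∘ σ = w := by
  rw [fixedWords, Finset.mem_filter, mem_words]

/-- The character of the permutation module `M^d`; it is `0` unless the degree of `d` is the number
of positions. -/
def permChar {E : Type*} [Fintype E] [DecidableEq E] (d : ℕ →₀ ℕ) (σ : Equiv.Perm E) : ℂ :=
  (fixedWords d σ).card

instance {n : ℕ} (d : ℕ →₀ ℕ) : Finite {w : Fin n → ℕ | content w = d} :=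
  Set.Finite.to_subtype ((words (Fin n) d).finite_toSet.subset fun _ hw => mem_words.2 hw)

/-- The basis of `M^d` given by the words of content `d`. -/
def permBasis (n : ℕ) (d : ℕ →₀ ℕ) :
    Module.Basis {w : Fin n → ℕ | content w = d} ℂ (permSub n d).toSubmodule :=
  .ofRepr (Finsupp.supportedEquivFinsupp {w : Fin n → ℕ | content w = d})

theorem coe_permBasis {n : ℕ} (d : ℕ →₀ ℕ) (w : {w : Fin n → ℕ | content w = d}) :
    (permBasis n d w : (Fin n → ℕ) →₀ ℂ) = Finsupp.single w.1 1 := by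
  classical
  change ((Finsupp.supportedEquivFinsupp (M := ℂ) (R := ℂ) {w : Fin n → ℕ | content w = d}).symm
    (Finsupp.single w 1) : (Fin n → ℕ) →₀ ℂ) = _
  rw [Finsupp.supportedEquivFinsupp_symm_single]

theorem permBasis_repr {n : ℕ} (d : ℕ →₀ ℕ) (v : (permSub n d).toSubmodule)
    (w : {w : Fin n → ℕ | content w = d}) :
    (permBasis n d).repr v w = (v : (Fin n → ℕ) →₀ ℂ) w.1 := rfl

instance {n : ℕ} (d : ℕ →₀ ℕ) : FiniteDimensional ℂ (permSub n d).toSubmodule :=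
  Module.Finite.of_basis (permBasis n d)

theorem trace_permSub {n : ℕ} (d : ℕ →₀ ℕ) (σ : Equiv.Perm (Fin n)) :
    LinearMap.trace ℂ _ ((permSub n d).toRepresentation σ) = permChar d σ := by
  classical
  have := Fintype.ofFinite {w : Fin n → ℕ | content w = d}
  rw [LinearMap.trace_eq_matrix_trace ℂ (permBasis n d), Matrix.trace]
  have h : ∀ w : {w : Fin n → ℕ | content w = d},
      (LinearMap.toMatrix (permBasis n d) (permBasis n d)
        ((permSub n d).toRepresentation σ)).diag w = if w.1 ∘ σ = w.1 then 1 else 0 := by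
    intro w
    rw [Matrix.diag_apply, LinearMap.toMatrix_apply, permBasis_repr]
    change wordRep n σ (permBasis n d w) w.1 = _
    rw [coe_permBasis, wordRep_single, Finsupp.single_apply]
    refine if_congr ⟨fun h => ?_, fun h => ?_⟩ rfl rfl
    · conv_lhs => rw [← h]
      funext e
      simp
    · conv_lhs => rw [← h]
      funext e
      simp
  rw [Finset.sum_congr rfl fun w _ => h w, Finset.sum_boole, permChar]
  congr 1
  refine Finset.card_bij (fun w _ => w.1) ?_ ?_ ?_
  · intro w hw
    exact mem_fixedWords.2 ⟨w.2, (Finset.mem_filter.1 hw).2⟩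
  · intro w _ w' _ h
    exact Subtype.ext h
  · intro w hw
    rw [mem_fixedWords] at hw
    exact ⟨⟨w, hw.1⟩, by simp [hw.2], rfl⟩

theorem pairing_chi_permChar_eq_finrank {n : ℕ} (p : n.Partition) (d : ℕ →₀ ℕ) :
    pairing (chi p) (permChar d) = Module.finrank ℂ
      (Representation.IntertwiningMap (specht p) (permSub n d).toRepresentation) := by
  have h := card_inv_mul_sum_trace (spechtSub p) (permSub n d)
  refine Eq.trans ?_ h
  refine congrArg _ (Finset.sum_congr rfl fun σ _ => ?_)
  rw [mul_comm, ← chi_inv p, ← trace_permSub]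
  rfl

theorem pairing_chi_permChar_self {n : ℕ} (p : n.Partition) :
    pairing (chi p) (permChar (rowContent (diagram p))) = 1 := by
  rw [pairing_chi_permChar_eq_finrank]
  have h := finrank_hom_eq_one (permSub_le _ _ le_rfl) (spechtSub_le_permSub p)
  exact_mod_cast congrArg (Nat.cast (R := ℂ)) h

theorem pairing_chi_permChar_eq_zero {n : ℕ} (p : n.Partition) {d : ℕ →₀ ℕ}
    (hd : d ≠ rowContent (diagram p)) (hw : weight d ≤ weight (rowContent (diagram p))) :
    pairing (chi p) (permChar d) = 0 := by
  rw [pairing_chi_permChar_eq_finrank]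
  have h := finrank_hom_eq_zero (permSub_le d _ hw) fun T => polytabloid_notMem_permSub T hd
  exact_mod_cast congrArg (Nat.cast (R := ℂ)) h

theorem permChar_conj {E : Type*} [Fintype E] [DecidableEq E] (d : ℕ →₀ ℕ)
    (g h : Equiv.Perm E) : permChar d (h * g * h⁻¹) = permChar d g := by
  unfold permChar
  congr 1
  refine Finset.card_bij' (fun w _ => w ∘ h) (fun w _ => w ∘ ⇑h⁻¹) ?_ ?_ ?_ ?_
  · intro w hw
    rw [mem_fixedWords] at hw ⊢
    refine ⟨(content_comp_equiv h w).trans hw.1, ?_⟩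
    funext e
    simpa using congrFun hw.2 (h e)
  · intro w hw
    rw [mem_fixedWords] at hw ⊢
    refine ⟨(content_comp_equiv h⁻¹ w).trans hw.1, ?_⟩
    funext e
    simpa using congrFun hw.2 (h⁻¹ e)
  · intro w _
    funext e
    simp
  · intro w _
    funext e
    simp

/-! ### Completeness of the Specht characters -/

/-- The Specht characters are orthonormal, and there are as many of them as there are cycle types;
hence they form an orthonormal basis of the class functions. -/
theorem eq_sum_chi {n : ℕ} (f : Equiv.Perm (Fin n) → ℂ)
    (hf : ∀ g h, f (h * g * h⁻¹) = f g) (σ : Equiv.Perm (Fin n)) :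
    f σ = ∑ p, pairing (chi p) f * chi p σ := by
  classical
  have hlift : ∀ f : Equiv.Perm (Fin n) → ℂ, (∀ g h, f (h * g * h⁻¹) = f g) →
      ∃ F : ConjClasses (Equiv.Perm (Fin n)) → ℂ, ∀ σ, F (ConjClasses.mk σ) = f σ := by
    intro f hf
    refine ⟨Quotient.lift f ?_, fun σ => rfl⟩
    intro a b hab
    obtain ⟨c, hc⟩ := isConj_iff.1 hab
    rw [← hc, hf]
  choose X hX using fun p : n.Partition => hlift (chi p) (chi_conj p)
  obtain ⟨F, hF⟩ := hlift f hf
  have hli : LinearIndependent ℂ X := by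
    rw [Fintype.linearIndependent_iff]
    intro c hc q
    have h1 : (fun σ : Equiv.Perm (Fin n) => ∑ p, c p * chi p σ) = fun _ => 0 := by
      funext σ
      have := congrFun hc (ConjClasses.mk σ)
      simpa [Finset.sum_apply, hX] using this
    have h2 := pairing_sum_right Finset.univ (chi q) c chi
    rw [h1] at h2
    simpa [pairing_chi_chi, show pairing (chi q) (fun _ => 0) = 0 by simp [pairing]] using h2.symm
  have hcard : Fintype.card n.Partition =
      Module.finrank ℂ (ConjClasses (Equiv.Perm (Fin n)) → ℂ) := by
    refine le_antisymm hli.fintype_card_le_finrank ?_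
    rw [Module.finrank_pi]
    have h : Fintype.card (ConjClasses (Equiv.Perm (Fin n))) ≤
        Fintype.card (Fintype.card (Fin n)).Partition := by
      refine Fintype.card_le_of_injective
        (Quotient.lift (fun σ => Equiv.Perm.partition σ)
          fun _ _ h => Equiv.Perm.partition_eq_of_isConj.1 h) ?_
      rintro ⟨a⟩ ⟨b⟩ h
      exact Quotient.sound (Equiv.Perm.partition_eq_of_isConj.2 h)
    rwa [Fintype.card_fin] at h
  have hspan := hli.span_eq_top_of_card_eq_finrank' hcard
  have hFmem : F ∈ Submodule.span ℂ (Set.range X) := hspan ▸ Submodule.mem_top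
  obtain ⟨c, hc⟩ := (Submodule.mem_span_range_iff_exists_fun ℂ).1 hFmem
  have hfc : f = fun σ => ∑ p, c p * chi p σ := by
    funext σ
    rw [← hF, ← hc]
    simp [Finset.sum_apply, hX]
  have hpair : ∀ q, pairing (chi q) f = c q := by
    intro q
    rw [hfc, pairing_sum_right]
    simp [pairing_chi_chi]
  rw [Finset.sum_congr rfl fun p _ => by rw [hpair p]]
  exact congrFun hfc σ

/-- Parseval's identity for class functions on `S_n`. -/
theorem pairing_eq_sum {n : ℕ} (f g : Equiv.Perm (Fin n) → ℂ)
    (hg : ∀ σ τ, g (τ * σ * τ⁻¹) = g σ) :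
    pairing f g = ∑ p, pairing (chi p) f * pairing (chi p) g := by
  conv_lhs => rw [show g = fun σ => ∑ p, pairing (chi p) g * chi p σ from
    funext (eq_sum_chi g hg)]
  rw [pairing_sum_right]
  exact Finset.sum_congr rfl fun p _ => by rw [pairing_comm f, mul_comm]

/-- Column orthogonality. -/
theorem sum_chi_mul_chi {n : ℕ} (σ τ : Equiv.Perm (Fin n)) :
    ∑ p, chi p σ * chi p τ =
      ((Finset.univ.filter fun g : Equiv.Perm (Fin n) => g * σ * g⁻¹ = τ).card : ℂ) := by
  classical
  set f : Equiv.Perm (Fin n) → ℂ := fun τ =>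
    ((Finset.univ.filter fun g : Equiv.Perm (Fin n) => g * σ * g⁻¹ = τ).card : ℂ) with hf
  have hclass : ∀ g h, f (h * g * h⁻¹) = f g := by
    intro g h
    rw [hf]
    simp only
    congr 1
    refine Finset.card_bij' (fun x _ => h⁻¹ * x) (fun x _ => h * x) ?_ ?_ ?_ ?_
    · intro x hx
      simp only [Finset.mem_filter, Finset.mem_univ, true_and] at hx ⊢
      rw [mul_inv_rev, inv_inv]
      calc h⁻¹ * x * σ * (x⁻¹ * h) = h⁻¹ * (x * σ * x⁻¹) * h := by group
        _ = g := by rw [hx]; group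
    · intro x hx
      simp only [Finset.mem_filter, Finset.mem_univ, true_and] at hx ⊢
      rw [← hx]
      group
    · intro x _
      group
    · intro x _
      group
  have hpair : ∀ p, pairing (chi p) f = chi p σ := by
    intro p
    have h1 : ∀ x, chi p x * f x =
        ∑ g : Equiv.Perm (Fin n), if g * σ * g⁻¹ = x then chi p σ else 0 := by
      intro x
      rw [hf]
      simp only
      rw [Finset.card_filter, Nat.cast_sum, Finset.mul_sum]
      refine Finset.sum_congr rfl fun g _ => ?_
      split_ifs with h
      · rw [← h, chi_conj, Nat.cast_one, mul_one]
      · simp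
    rw [pairing, Finset.sum_congr rfl fun x _ => h1 x, Finset.sum_comm]
    simp only [Finset.sum_ite_eq, Finset.mem_univ, if_true, Finset.sum_const, Finset.card_univ,
      nsmul_eq_mul]
    rw [inv_mul_cancel_left₀]
    exact Nat.cast_ne_zero.2 Fintype.card_ne_zero
  have := eq_sum_chi f hclass τ
  rw [Finset.sum_congr rfl fun p _ => by rw [hpair p]] at this
  exact this.symm

/-! ### Positivity -/

theorem finrank_specht_pos {n : ℕ} (p : n.Partition) :
    0 < Module.finrank ℂ (spechtSub p).toSubmodule := by
  obtain ⟨T⟩ : Nonempty (Tableau p) := inferInstance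
  rw [Nat.pos_iff_ne_zero, Ne, Submodule.finrank_eq_zero]
  intro h
  exact polytabloid_ne_zero T ((Submodule.eq_bot_iff _).1 h _ (polytabloid_mem T))

/-- A Specht character is proportional to an idempotent of the group algebra, since
`∑ χ(g) g` acts on the Specht module by a scalar. -/
theorem exists_chi_convolution {n : ℕ} (p : n.Partition) :
    ∃ c : ℝ, 0 < c ∧ ∀ x, ∑ g, chi p g * chi p (g⁻¹ * x) = c * chi p x := by
  classical
  let Z : Representation.IntertwiningMap (specht p) (specht p) :=
    { ∑ g, chi p g • specht p g with
      isIntertwining' := fun h => by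
        refine LinearMap.ext fun v => ?_
        change (∑ g, chi p g • specht p g) (specht p h v) =
          specht p h ((∑ g, chi p g • specht p g) v)
        simp only [LinearMap.sum_apply, LinearMap.smul_apply, map_sum, map_smul]
        refine Finset.sum_bij' (fun g _ => h⁻¹ * g * h) (fun g _ => h * g * h⁻¹) ?_ ?_ ?_ ?_ ?_
        · simp
        · simp
        · intro g _
          group
        · intro g _
          group
        · intro g _
          have : chi p (h⁻¹ * g * h) = chi p g := by
            simpa using chi_conj p g h⁻¹
          rw [this, ← Module.End.mul_apply, ← Module.End.mul_apply, ← map_mul, ← map_mul]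
          congr 3
          group }
  -- the scalar is `n! / dim S_p`, as the trace shows
  obtain ⟨c, hc⟩ := exists_smul_of_intertwining (spechtSub_le_supported p le_rfl) Z
  have hZ : (∑ g, chi p g • specht p g) = c • (1 : Module.End ℂ (spechtSub p).toSubmodule) :=
    LinearMap.ext fun v => Subtype.ext (hc v)
  have htr : ∀ x, ∑ g, chi p g * chi p (g * x) = c * chi p x := by
    intro x
    have h1 := congrArg (fun Y => LinearMap.trace ℂ _ (Y * specht p x)) hZ
    simp only [Finset.sum_mul, map_sum, smul_mul_assoc, map_smul, one_mul, ← map_mul,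
      smul_eq_mul] at h1
    exact h1
  have hd := finrank_specht_pos p
  have hcd : c * (Module.finrank ℂ (spechtSub p).toSubmodule : ℂ) = Nat.factorial n := by
    have h1 := htr 1
    have h2 : chi p 1 = Module.finrank ℂ (spechtSub p).toSubmodule := by
      exact trace_subrepresentation_one (spechtSub p)
    have h3 := pairing_chi_self p
    rw [pairing, inv_mul_eq_one₀ (Nat.cast_ne_zero.2 Fintype.card_ne_zero)] at h3
    simp only [mul_one] at h1
    rw [← h2, ← h1, ← h3, Fintype.card_perm, Fintype.card_fin]
  refine ⟨Nat.factorial n / Module.finrank ℂ (spechtSub p).toSubmodule, by positivity, ?_⟩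
  intro x
  have hc' : c = Nat.factorial n / Module.finrank ℂ (spechtSub p).toSubmodule := by
    rw [eq_div_iff (Nat.cast_ne_zero.2 hd.ne'), hcd]
  push_cast
  rw [← hc', ← htr, ← Equiv.sum_comp (Equiv.inv _)]
  refine Finset.sum_congr rfl fun g _ => ?_
  rw [Equiv.inv_apply, chi_inv, inv_inv]

/-- A function on a finite group that is a positive multiple of an idempotent for convolution
pairs nonnegatively with every character: the pairing is a positive multiple of the trace of an
idempotent operator. -/
theorem pairing_trace_nonneg {G V : Type*} [Group G] [Fintype G] [AddCommGroup V] [Module ℂ V]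
    [FiniteDimensional ℂ V] (ρ : Representation ℂ G V) (ψ : G → ℂ) (c : ℝ) (hc : 0 < c)
    (hψ : ∀ x, ∑ g, ψ g * ψ (g⁻¹ * x) = c * ψ x) :
    ∃ t : ℝ, 0 ≤ t ∧ pairing ψ (fun g => LinearMap.trace ℂ V (ρ g)) = t := by
  classical
  set P : Module.End ℂ V := ∑ g, ψ g • ρ g with hP
  have hPP : P * P = (c : ℂ) • P := by
    have h1 : ∀ g, ∑ h, (ψ g * ψ h) • ρ (g * h) = ∑ x, (ψ g * ψ (g⁻¹ * x)) • ρ x := by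
      intro g
      rw [← Equiv.sum_comp (Equiv.mulLeft g) fun x => (ψ g * ψ (g⁻¹ * x)) • ρ x]
      simp only [Equiv.coe_mulLeft, inv_mul_cancel_left]
    rw [hP, Finset.sum_mul]
    simp only [Finset.mul_sum, smul_mul_assoc, mul_smul_comm, smul_smul, ← map_mul]
    rw [Finset.sum_congr rfl fun g _ => Finset.sum_congr rfl fun h _ => by rw [mul_comm (ψ h)]]
    rw [Finset.sum_congr rfl fun g _ => h1 g, Finset.sum_comm, Finset.smul_sum]
    refine Finset.sum_congr rfl fun x _ => ?_
    rw [← Finset.sum_smul, hψ, smul_smul]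
  have hc0 : (c : ℂ) ≠ 0 := Complex.ofReal_ne_zero.2 hc.ne'
  have hid : IsIdempotentElem ((c : ℂ)⁻¹ • P) := by
    rw [IsIdempotentElem, smul_mul_smul_comm, hPP, smul_smul, mul_assoc, inv_mul_cancel₀ hc0,
      mul_one]
  have htr := (LinearMap.IsIdempotentElem.isProj_range _ hid).trace
  rw [map_smul, smul_eq_mul, inv_mul_eq_iff_eq_mul₀ hc0] at htr
  refine ⟨(Fintype.card G : ℝ)⁻¹ * (c * Module.finrank ℂ (LinearMap.range ((c : ℂ)⁻¹ • P))),
    by positivity, ?_⟩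
  push_cast
  rw [← htr, hP, map_sum, pairing]
  simp only [map_smul, smul_eq_mul]

/-- The case of a character restricted along a group homomorphism. -/
theorem pairing_trace_comp_nonneg {G H V : Type*} [Group G] [Group H] [Fintype H]
    [AddCommGroup V] [Module ℂ V] {ρ : Representation ℂ G V} (A : Subrepresentation ρ)
    [FiniteDimensional ℂ A.toSubmodule] (φ : H →* G) (ψ : H → ℂ) (c : ℝ) (hc : 0 < c)
    (hψ : ∀ x, ∑ g, ψ g * ψ (g⁻¹ * x) = c * ψ x) :
    ∃ t : ℝ, 0 ≤ t ∧
      pairing ψ (fun g => LinearMap.trace ℂ _ (A.toRepresentation (φ g))) = t :=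
  pairing_trace_nonneg (A.toRepresentation.comp φ) ψ c hc hψ

/-! ### Frobenius reciprocity for permutation characters -/

theorem exists_equiv_of_content_eq {E F : Type*} [Fintype E] [Fintype F] {w : E → ℕ} {w' : F → ℕ}
    (h : content w = content w') : ∃ τ : E ≃ F, w = w' ∘ τ := by
  classical
  have hcard : ∀ c, Fintype.card {x // w x = c} = Fintype.card {x // w' x = c} := by
    intro c
    rw [Fintype.card_subtype, Fintype.card_subtype, ← content_apply, ← content_apply, h]
  refine ⟨Equiv.ofFiberEquiv fun c => Fintype.equivOfCardEq (hcard c), ?_⟩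
  funext x
  exact (Equiv.ofFiberEquiv_map _ x).symm

/-- The permutations that preserve the word `w`. -/
def wordStab {E : Type*} [Fintype E] [DecidableEq E] (w : E → ℕ) : Finset (Equiv.Perm E) :=
  Finset.univ.filter fun σ => w ∘ σ = w

theorem mem_wordStab {E : Type*} [Fintype E] [DecidableEq E] {w : E → ℕ} {σ : Equiv.Perm E} :
    σ ∈ wordStab w ↔ w ∘ σ = w := by
  simp [wordStab]

theorem card_perm_eq_card_words_mul {E : Type*} [Fintype E] [DecidableEq E] (w : E → ℕ) :
    Fintype.card (Equiv.Perm E) = (words E (content w)).card * (wordStab w).card := by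
  classical
  rw [← Finset.card_univ, Finset.card_eq_sum_card_fiberwise
    (f := fun τ : Equiv.Perm E => w ∘ τ) (t := words E (content w))
    (fun τ _ => mem_words.2 (content_comp_equiv τ w)), Finset.sum_const_nat]
  intro v hv
  obtain ⟨τ₀, rfl⟩ := exists_equiv_of_content_eq (mem_words.1 hv)
  refine Finset.card_bij' (fun τ _ => τ * τ₀⁻¹) (fun τ _ => τ * τ₀) ?_ ?_ ?_ ?_
  · intro τ hτ
    rw [Finset.mem_filter] at hτ
    rw [mem_wordStab]
    funext e
    simpa using congrFun hτ.2 (τ₀⁻¹ e)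
  · intro τ hτ
    rw [mem_wordStab] at hτ
    rw [Finset.mem_filter]
    refine ⟨Finset.mem_univ _, ?_⟩
    funext e
    exact congrFun hτ (τ₀ e)
  · intro τ _
    group
  · intro τ _
    group

/-- Frobenius reciprocity: the words of a given content form a single orbit, so that the permutation
module is induced from the trivial representation of a stabilizer. -/
theorem pairing_permChar {E : Type*} [Fintype E] [DecidableEq E] (w : E → ℕ)
    (f : Equiv.Perm E → ℂ) (hf : ∀ g h, f (h * g * h⁻¹) = f g) :
    pairing f (permChar (content w)) = ((wordStab w).card : ℂ)⁻¹ * ∑ σ ∈ wordStab w, f σ := by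
  classical
  have h1 : ∀ v ∈ words E (content w),
      ∑ σ ∈ wordStab v, f σ = ∑ σ ∈ wordStab w, f σ := by
    intro v hv
    obtain ⟨τ₀, rfl⟩ := exists_equiv_of_content_eq (mem_words.1 hv)
    refine Finset.sum_bij' (fun τ _ => τ₀ * τ * τ₀⁻¹) (fun τ _ => τ₀⁻¹ * τ * τ₀) ?_ ?_ ?_ ?_ ?_
    · intro τ hτ
      rw [mem_wordStab] at hτ ⊢
      funext e
      simpa using congrFun hτ (τ₀⁻¹ e)
    · intro τ hτ
      rw [mem_wordStab] at hτ ⊢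
      funext e
      simpa using congrFun hτ (τ₀ e)
    · intro τ _
      group
    · intro τ _
      group
    · intro τ _
      rw [hf]
  have h2 : ∑ σ, f σ * permChar (content w) σ =
      (words E (content w)).card * ∑ σ ∈ wordStab w, f σ := by
    have h3 : ∀ σ, f σ * permChar (content w) σ =
        ∑ v ∈ words E (content w), if v ∘ σ = v then f σ else 0 := by
      intro σ
      rw [permChar, fixedWords, Finset.card_filter, Nat.cast_sum, Finset.mul_sum]
      refine Finset.sum_congr rfl fun v _ => ?_
      split_ifs <;> simp
    rw [Finset.sum_congr rfl fun σ _ => h3 σ, Finset.sum_comm,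
      Finset.sum_congr rfl fun v hv => (Finset.sum_filter _ _).symm.trans (h1 v hv),
      Finset.sum_const, nsmul_eq_mul]
  have hne : ((words E (content w)).card : ℂ) ≠ 0 :=
    Nat.cast_ne_zero.2 (Finset.card_ne_zero_of_mem (mem_words.2 (rfl : content w = _)))
  rw [pairing, h2, card_perm_eq_card_words_mul w, Nat.cast_mul, mul_inv, mul_mul_mul_comm,
    inv_mul_cancel₀ hne, one_mul]

theorem content_eq_toFinsupp {E : Type*} [Fintype E] (w : E → ℕ) :
    content w = Multiset.toFinsupp (Finset.univ.val.map w) := by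
  ext i
  rw [content_apply, Multiset.toFinsupp_apply, Multiset.count_map]
  simp only [eq_comm]
  rfl

theorem exists_content_eq {m : ℕ} (d : ℕ →₀ ℕ) (hd : d.degree = m) :
    ∃ w : Fin m → ℕ, content w = d := by
  obtain ⟨l, hl⟩ := Quot.exists_rep (Finsupp.toMultiset d)
  have hlen : l.length = m := by
    have h := Finsupp.card_toMultiset d
    rw [← hl] at h
    rw [← hd, Finsupp.degree_apply]
    exact h
  subst hlen
  refine ⟨l.get, ?_⟩
  rw [content_eq_toFinsupp, Fin.univ_val_map, List.ofFn_get, Multiset.toFinsupp_eq_iff]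
  exact hl

theorem pairing_one_permChar (m : ℕ) (d : ℕ →₀ ℕ) :
    pairing (fun _ => 1) (permChar (E := Fin m) d) = if d.degree = m then 1 else 0 := by
  split_ifs with h
  · obtain ⟨w, rfl⟩ := exists_content_eq d h
    rw [pairing_permChar w (fun _ => 1) (fun _ _ => rfl), Finset.sum_const, nsmul_eq_mul, mul_one,
      inv_mul_cancel₀]
    refine Nat.cast_ne_zero.2 (Finset.card_ne_zero_of_mem (a := 1) (mem_wordStab.2 ?_))
    rfl
  · have h0 : ∀ σ : Equiv.Perm (Fin m), permChar d σ = 0 := by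
      intro σ
      rw [permChar, Nat.cast_eq_zero, Finset.card_eq_zero, Finset.eq_empty_iff_forall_notMem]
      intro w hw
      apply h
      rw [← (mem_fixedWords.1 hw).1, degree_content, Fintype.card_fin]
    simp [pairing, h0]

/-! ### Young subgroups -/

section Young

variable {k n : ℕ} {a : Fin k → ℕ}

/-- The embedding `S_{a_1} × ⋯ × S_{a_k} → S_n` of a Young subgroup, for a given arrangement of
the `k` blocks in `Fin n`. -/
def youngEmb (e : (Σ i, Fin (a i)) ≃ Fin n) :
    (∀ i, Equiv.Perm (Fin (a i))) →* Equiv.Perm (Fin n) :=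
  e.permCongrHom.toMonoidHom.comp (Equiv.Perm.sigmaCongrRightHom fun i => Fin (a i))

theorem youngEmb_apply (e : (Σ i, Fin (a i)) ≃ Fin n) (h : ∀ i, Equiv.Perm (Fin (a i)))
    (x : Σ i, Fin (a i)) : youngEmb e h (e x) = e ⟨x.1, h x.1 x.2⟩ := by
  simp [youngEmb, Equiv.permCongrHom, Equiv.permCongr_apply]

theorem youngEmb_injective (e : (Σ i, Fin (a i)) ≃ Fin n) : Function.Injective (youngEmb e) :=
  e.permCongrHom.injective.comp Equiv.Perm.sigmaCongrRightHom_injective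

/-- The word of block indices. -/
def blockWord (e : (Σ i, Fin (a i)) ≃ Fin n) (x : Fin n) : ℕ := (e.symm x).1

/-- The composition `a` as an exponent vector. -/
def expo (a : Fin k → ℕ) : ℕ →₀ ℕ :=
  Finsupp.embDomain (Fin.valEmbedding : Fin k ↪ ℕ) (Finsupp.equivFunOnFinite.symm a)

theorem expo_eq_sum (a : Fin k → ℕ) : expo a = ∑ i : Fin k, Finsupp.single (i : ℕ) (a i) := by
  have h : Finsupp.equivFunOnFinite.symm a = ∑ i, Finsupp.single i (a i) := by
    ext i
    simp [Finsupp.finsetSum_apply, Finsupp.single_apply]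
  rw [expo, h, Finsupp.embDomain_eq_mapDomain, Finsupp.mapDomain_finsetSum]
  simp [Finsupp.mapDomain_single]

theorem degree_expo (a : Fin k → ℕ) : (expo a).degree = ∑ i, a i := by
  simp [expo_eq_sum, map_sum]

theorem content_blockWord (e : (Σ i, Fin (a i)) ≃ Fin n) : content (blockWord e) = expo a := by
  rw [content, ← Equiv.sum_comp e, Fintype.sum_sigma, expo_eq_sum]
  refine Finset.sum_congr rfl fun i _ => ?_
  simp [blockWord]

theorem mem_wordStab_blockWord (e : (Σ i, Fin (a i)) ≃ Fin n) (σ : Equiv.Perm (Fin n)) :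
    σ ∈ wordStab (blockWord e) ↔ ∃ h, youngEmb e h = σ := by
  rw [mem_wordStab]
  constructor
  · intro hσ
    have h1 : ∀ i (j : Fin (a i)), ∃ j' : Fin (a i), e.symm (σ (e ⟨i, j⟩)) = ⟨i, j'⟩ := by
      intro i j
      have h2 := congrFun hσ (e ⟨i, j⟩)
      simp only [Function.comp_apply, blockWord, Equiv.symm_apply_apply] at h2
      have h3 := Fin.val_injective h2
      generalize e.symm (σ (e ⟨i, j⟩)) = y at h3
      obtain ⟨i', j'⟩ := y
      simp only at h3
      subst h3
      exact ⟨j', rfl⟩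
    choose g hg using h1
    have hinj : ∀ i, Function.Injective (g i) := by
      intro i j j' hjj
      have h2 : e.symm (σ (e ⟨i, j⟩)) = e.symm (σ (e ⟨i, j'⟩)) := by rw [hg, hg, hjj]
      simpa using h2
    refine ⟨fun i => Equiv.ofBijective (g i) (Finite.injective_iff_bijective.1 (hinj i)), ?_⟩
    ext1 x
    obtain ⟨⟨i, j⟩, rfl⟩ := e.surjective x
    rw [youngEmb_apply, Equiv.ofBijective_apply, ← hg, Equiv.apply_symm_apply]
  · rintro ⟨h, rfl⟩
    funext x
    obtain ⟨y, rfl⟩ := e.surjective x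
    rw [Function.comp_apply, youngEmb_apply]
    simp [blockWord]

/-- The stabilizer of the word of block indices is the Young subgroup. -/
theorem pairing_permChar_expo (e : (Σ i, Fin (a i)) ≃ Fin n) (f : Equiv.Perm (Fin n) → ℂ)
    (hf : ∀ g h, f (h * g * h⁻¹) = f g) :
    pairing f (permChar (expo a)) = pairing (fun h => f (youngEmb e h)) (fun _ => 1) := by
  classical
  have himg : wordStab (blockWord e) = Finset.univ.image (youngEmb e) := by
    ext σ
    rw [mem_wordStab_blockWord]
    simp
  rw [← content_blockWord e, pairing_permChar _ _ hf, himg,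
    Finset.card_image_of_injective _ (youngEmb_injective e),
    Finset.sum_image (youngEmb_injective e).injOn, Finset.card_univ, pairing]
  simp only [mul_one]

/-- The restriction of a permutation character to a Young subgroup: a word fixed by the image of `h`
consists of words on the blocks, fixed by the components of `h`, whose contents add up. -/
theorem permChar_youngEmb (e : (Σ i, Fin (a i)) ≃ Fin n) (b : ℕ →₀ ℕ)
    (h : ∀ i, Equiv.Perm (Fin (a i))) :
    permChar b (youngEmb e h) =
      ∑ A ∈ Finset.finsuppAntidiag (Finset.univ : Finset (Fin k)) b,
        ∏ i, permChar (A i) (h i) := by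
  classical
  have hsum : ∀ w : Fin n → ℕ, ∑ i, content (fun j => w (e ⟨i, j⟩)) = content w := by
    intro w
    rw [content, ← Equiv.sum_comp e, Fintype.sum_sigma]
    rfl
  unfold permChar
  rw [Finset.card_eq_sum_card_fiberwise
    (f := fun w : Fin n → ℕ => (Finsupp.equivFunOnFinite.symm fun i =>
      content fun j => w (e ⟨i, j⟩) : Fin k →₀ (ℕ →₀ ℕ)))
    (t := Finset.finsuppAntidiag (Finset.univ : Finset (Fin k)) b), Nat.cast_sum]
  · refine Finset.sum_congr rfl fun A hA => ?_
    rw [Finset.mem_finsuppAntidiag] at hA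
    rw [← Nat.cast_prod, ← Fintype.card_piFinset]
    congr 1
    refine Finset.card_bij' (fun w _ i j => w (e ⟨i, j⟩))
      (fun u _ x => u (e.symm x).1 (e.symm x).2) ?_ ?_ ?_ ?_
    · intro w hw
      rw [Finset.mem_filter, mem_fixedWords] at hw
      rw [Fintype.mem_piFinset]
      intro i
      rw [mem_fixedWords]
      refine ⟨DFunLike.congr_fun hw.2 i, ?_⟩
      funext j
      have := congrFun hw.1.2 (e ⟨i, j⟩)
      rwa [Function.comp_apply, youngEmb_apply] at this
    · intro u hu
      have hue : ∀ x : Σ i, Fin (a i), u (e.symm (e x)).1 (e.symm (e x)).2 = u x.1 x.2 := by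
        intro x
        rw [e.symm_apply_apply]
      rw [Fintype.mem_piFinset] at hu
      have hu' := fun i => mem_fixedWords.1 (hu i)
      rw [Finset.mem_filter, mem_fixedWords]
      refine ⟨⟨?_, ?_⟩, ?_⟩
      · rw [← hsum, ← hA.1]
        refine Finset.sum_congr rfl fun i _ => ?_
        rw [← (hu' i).1]
        exact congrArg content (funext fun j => hue ⟨i, j⟩)
      · funext x
        obtain ⟨y, rfl⟩ := e.surjective x
        rw [Function.comp_apply, youngEmb_apply, hue, hue]
        exact congrFun (hu' y.1).2 y.2
      · refine Finsupp.ext fun i => ?_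
        rw [← (hu' i).1]
        exact congrArg content (funext fun j => hue ⟨i, j⟩)
    · intro w _
      funext x
      simp
    · intro u _
      funext i j
      change u (e.symm (e ⟨i, j⟩)).1 (e.symm (e ⟨i, j⟩)).2 = u i j
      rw [e.symm_apply_apply]
  · intro w hw
    rw [Finset.mem_coe, Finset.mem_finsuppAntidiag]
    refine ⟨?_, Finset.subset_univ _⟩
    rw [← (mem_fixedWords.1 hw).1, ← hsum]
    rfl

theorem pairing_prod (f g : ∀ i, Equiv.Perm (Fin (a i)) → ℂ) :
    pairing (fun h : ∀ i, Equiv.Perm (Fin (a i)) => ∏ i, f i (h i))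
      (fun h => ∏ i, g i (h i)) = ∏ i, pairing (f i) (g i) := by
  classical
  unfold pairing
  rw [Finset.prod_mul_distrib, Fintype.prod_sum, Fintype.card_pi, Nat.cast_prod,
    Finset.prod_inv_distrib]
  simp only [Finset.prod_mul_distrib]

theorem exists_blockEquiv (a : Fin k → ℕ) (h : ∑ i, a i = n) :
    Nonempty ((Σ i, Fin (a i)) ≃ Fin n) :=
  ⟨Fintype.equivOfCardEq (by simp [h])⟩

/-- The pairing of two permutation characters counts the nonnegative integer matrices with given
row and column sums. -/
theorem pairing_permChar_permChar (b : ℕ →₀ ℕ) (h : ∑ i, a i = n) :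
    pairing (permChar (E := Fin n) b) (permChar (expo a)) =
      (((Finset.finsuppAntidiag (Finset.univ : Finset (Fin k)) b).filter
        fun A => ∀ i, (A i).degree = a i).card : ℂ) := by
  classical
  obtain ⟨e⟩ := exists_blockEquiv a h
  rw [pairing_permChar_expo e _ (permChar_conj b), pairing_comm]
  simp only [permChar_youngEmb]
  have h1 := pairing_sum_right (Finset.finsuppAntidiag (Finset.univ : Finset (Fin k)) b)
    (fun _ : ∀ i, Equiv.Perm (Fin (a i)) => 1) (fun _ => 1) (fun A h => ∏ i, permChar (A i) (h i))
  simp only [one_mul] at h1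
  rw [h1, Finset.card_filter, Nat.cast_sum]
  refine Finset.sum_congr rfl fun A _ => ?_
  have h2 := pairing_prod (a := a) (fun i _ => 1) (fun i => permChar (A i))
  simp only [Finset.prod_const_one, pairing_one_permChar] at h2
  rw [h2, Finset.prod_ite_zero]
  simp

/-! ### Characters of Young subgroups -/

/-- The external product of Specht characters. -/
def chiProd (α : ∀ i, (a i).Partition) (h : ∀ i, Equiv.Perm (Fin (a i))) : ℂ :=
  ∏ i, chi (α i) (h i)

/-- Parseval's identity for class functions on a Young subgroup. -/
theorem sum_pairing_chiProd (f g : (∀ i, Equiv.Perm (Fin (a i))) → ℂ)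
    (hg : ∀ σ τ, g (τ * σ * τ⁻¹) = g σ) :
    ∑ α : ∀ i, (a i).Partition, pairing (chiProd α) f * pairing (chiProd α) g = pairing f g := by
  classical
  -- column orthogonality, from that of the factors
  have hcol : ∀ h h' : ∀ i, Equiv.Perm (Fin (a i)),
      ∑ α : ∀ i, (a i).Partition, chiProd α h * chiProd α h' =
        ∑ x : ∀ i, Equiv.Perm (Fin (a i)), if x * h * x⁻¹ = h' then 1 else 0 := by
    intro h h'
    simp only [chiProd, ← Finset.prod_mul_distrib]
    rw [← Fintype.prod_sum fun i (p : (a i).Partition) => chi p (h i) * chi p (h' i)]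
    simp only [sum_chi_mul_chi, Finset.card_filter, Nat.cast_sum]
    rw [Fintype.prod_sum]
    refine Finset.sum_congr rfl fun x _ => ?_
    simp only [Nat.cast_ite, Nat.cast_one, Nat.cast_zero]
    by_cases H : x * h * x⁻¹ = h'
    · rw [if_pos H]
      exact Finset.prod_eq_one fun i _ => if_pos (congrFun H i)
    · rw [if_neg H]
      obtain ⟨i, hi⟩ := Function.ne_iff.1 H
      exact Finset.prod_eq_zero (Finset.mem_univ i) (if_neg hi)
  set N : ℂ := (Fintype.card (∀ i, Equiv.Perm (Fin (a i))) : ℂ) with hN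
  have hN0 : N ≠ 0 := Nat.cast_ne_zero.2 Fintype.card_ne_zero
  calc ∑ α : ∀ i, (a i).Partition, pairing (chiProd α) f * pairing (chiProd α) g
      = N⁻¹ * N⁻¹ * ∑ h, ∑ h', f h * g h' *
          ∑ α : ∀ i, (a i).Partition, chiProd α h * chiProd α h' := by
        have : ∀ α : ∀ i, (a i).Partition, pairing (chiProd α) f * pairing (chiProd α) g =
            ∑ h, ∑ h', N⁻¹ * N⁻¹ * (f h * g h' * (chiProd α h * chiProd α h')) := by
          intro α
          rw [pairing, pairing, mul_mul_mul_comm, Finset.sum_mul_sum, Finset.mul_sum]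
          simp only [Finset.mul_sum]
          refine Finset.sum_congr rfl fun h _ => Finset.sum_congr rfl fun h' _ => ?_
          ring
        rw [Finset.sum_congr rfl fun α _ => this α, Finset.sum_comm]
        simp only [Finset.mul_sum]
        refine Finset.sum_congr rfl fun h _ => ?_
        rw [Finset.sum_comm]
    _ = N⁻¹ * N⁻¹ * ∑ h, ∑ x : ∀ i, Equiv.Perm (Fin (a i)), f h * g h := by
        congr 1
        refine Finset.sum_congr rfl fun h _ => ?_
        simp only [hcol, Finset.mul_sum, mul_ite, mul_one, mul_zero]
        rw [Finset.sum_comm]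
        refine Finset.sum_congr rfl fun x _ => ?_
        rw [Finset.sum_ite_eq, if_pos (Finset.mem_univ _), hg]
    _ = pairing f g := by
        simp only [Finset.sum_const, Finset.card_univ, nsmul_eq_mul, ← hN, ← Finset.mul_sum]
        rw [pairing, ← hN, mul_assoc, inv_mul_cancel_left₀ hN0]

theorem pairing_chiProd_nonneg (α : ∀ i, (a i).Partition) (e : (Σ i, Fin (a i)) ≃ Fin n)
    (p : n.Partition) :
    ∃ t : ℝ, 0 ≤ t ∧ pairing (chiProd α) (fun h => chi p (youngEmb e h)) = t := by
  classical
  choose c hc hconv using fun i => exists_chi_convolution (α i)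
  refine pairing_trace_comp_nonneg (spechtSub p) (youngEmb e) (chiProd α) (∏ i, c i)
    (Finset.prod_pos fun i _ => hc i) ?_
  intro x
  simp only [chiProd, ← Finset.prod_mul_distrib, Pi.mul_apply, Pi.inv_apply]
  rw [← Fintype.prod_sum fun i g => chi (α i) g * chi (α i) (g⁻¹ * x i)]
  simp only [hconv]
  rw [Finset.prod_mul_distrib]
  push_cast
  rfl

end Young

/-! ### Horizontal strips -/

/-- The Young diagram with row lengths `f 0 ≥ f 1 ≥ ⋯`, of which at most `N` are nonzero. -/
def ofRows (f : ℕ → ℕ) (hf : Antitone f) (N : ℕ) (_hN : f N = 0) : YoungDiagram where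
  cells := (Finset.range N ×ˢ Finset.range (f 0)).filter fun c => c.2 < f c.1
  isLowerSet := by
    rintro ⟨i, j⟩ ⟨i', j'⟩ ⟨hi, hj⟩ h
    simp only [Finset.coe_filter, Finset.mem_product, Finset.mem_range, Set.mem_ofPred_eq] at h ⊢
    have := hf hi
    simp only at hi hj this
    omega

theorem rowLen_ofRows (f : ℕ → ℕ) (hf : Antitone f) (N : ℕ) (hN : f N = 0) (i : ℕ) :
    (ofRows f hf N hN).rowLen i = f i := by
  have h : ∀ j, j < (ofRows f hf N hN).rowLen i ↔ j < f i := by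
    intro j
    rw [← YoungDiagram.mem_iff_lt_rowLen, ← YoungDiagram.mem_cells]
    simp only [ofRows, Finset.mem_filter, Finset.mem_product, Finset.mem_range]
    refine ⟨fun h => h.2, fun h => ⟨⟨?_, h.trans_le (hf (Nat.zero_le i))⟩, h⟩⟩
    by_contra hi
    have := hf (not_lt.1 hi)
    omega
  have h1 := h (f i)
  have h2 := h ((ofRows f hf N hN).rowLen i)
  omega

theorem ext_rowLen {r s : YoungDiagram} (h : ∀ i, r.rowLen i = s.rowLen i) : r = s :=
  rowContent_injective (Finsupp.ext fun i => by rw [rowContent_apply, rowContent_apply, h])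

theorem card_cells_eq_sum (r : YoungDiagram) (N : ℕ) (hN : r.rowLen N = 0) :
    r.cells.card = ∑ i ∈ Finset.range N, r.rowLen i := by
  rw [← degree_rowContent, Finsupp.degree_apply]
  simp only [← rowContent_apply]
  refine Finset.sum_subset ?_ fun i _ hi => Finsupp.notMem_support_iff.1 hi
  intro i hi
  rw [Finsupp.mem_support_iff, rowContent_apply] at hi
  rw [Finset.mem_range]
  by_contra h
  have := r.rowLen_anti _ _ (not_lt.1 h)
  omega

theorem exists_rowLen_eq_zero (r : YoungDiagram) : ∃ N, r.rowLen N = 0 := by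
  refine ⟨r.colLen 0, ?_⟩
  by_contra h
  have h1 := YoungDiagram.mem_iff_lt_rowLen.2 (Nat.pos_of_ne_zero h)
  exact (YoungDiagram.mem_iff_lt_colLen.1 h1).false

/-- `s / r` is a horizontal strip: the row lengths interlace,
`s_0 ≥ r_0 ≥ s_1 ≥ r_1 ≥ ⋯`. -/
def IsStrip (r s : YoungDiagram) : Prop :=
  ∀ i, s.rowLen (i + 1) ≤ r.rowLen i ∧ r.rowLen i ≤ s.rowLen i

instance : DecidableEq YoungDiagram := Classical.decEq _

instance (r s : YoungDiagram) : Decidable (IsStrip r s) := Classical.dec _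

/-- The Young diagrams with `n` cells. -/
def diagrams (n : ℕ) : Finset YoungDiagram := Finset.univ.map ⟨diagram (n := n), diagram_injective⟩

theorem mem_diagrams {n : ℕ} {r : YoungDiagram} : r ∈ diagrams n ↔ r.cells.card = n := by
  simp only [diagrams, Finset.mem_map, Finset.mem_univ, true_and, Function.Embedding.coeFn_mk]
  exact ⟨fun ⟨p, hp⟩ => hp ▸ card_diagram p, exists_diagram_eq r⟩

/-- The diagrams obtained from `r` by adding a horizontal strip of size `m`. -/
def stripAbove (r : YoungDiagram) (m : ℕ) : Finset YoungDiagram :=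
  (diagrams (r.cells.card + m)).filter fun s => IsStrip r s

/-- The diagrams obtained from `s` by removing a horizontal strip of size `m`. -/
def stripBelow (s : YoungDiagram) (m : ℕ) : Finset YoungDiagram :=
  (diagrams (s.cells.card - m)).filter fun r => IsStrip r s ∧ r.cells.card + m = s.cells.card

theorem mem_stripAbove {r s : YoungDiagram} {m : ℕ} :
    s ∈ stripAbove r m ↔ IsStrip r s ∧ r.cells.card + m = s.cells.card := by
  rw [stripAbove, Finset.mem_filter, mem_diagrams, and_comm, eq_comm]

theorem mem_stripBelow {r s : YoungDiagram} {m : ℕ} :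
    r ∈ stripBelow s m ↔ IsStrip r s ∧ r.cells.card + m = s.cells.card := by
  rw [stripBelow, Finset.mem_filter, mem_diagrams, and_iff_right_iff_imp]
  intro h
  omega

theorem IsStrip.le {r s : YoungDiagram} (h : IsStrip r s) : r ≤ s := by
  rintro ⟨i, j⟩ hc
  have h1 := YoungDiagram.mem_iff_lt_rowLen.1 hc
  exact YoungDiagram.mem_iff_lt_rowLen.2 (h1.trans_le (h i).2)

theorem IsStrip.card_le {r s : YoungDiagram} (h : IsStrip r s) : r.cells.card ≤ s.cells.card :=
  Finset.card_le_card (YoungDiagram.cells_subset_iff.2 h.le)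

/-- The size relation for the reflection that exchanges the diagrams `u` above `r` and `s` with
the diagrams `d` below them. -/
theorem card_reflect {r s u d : YoungDiagram} (hr : IsStrip r u) (hd : IsStrip d r)
    (h : ∀ i, d.rowLen i + u.rowLen (i + 1) =
      max (r.rowLen (i + 1)) (s.rowLen (i + 1)) + min (r.rowLen i) (s.rowLen i)) :
    d.cells.card + u.cells.card + max (r.rowLen 0) (s.rowLen 0) =
      r.cells.card + s.cells.card + u.rowLen 0 := by
  obtain ⟨N₁, hN₁⟩ := exists_rowLen_eq_zero r
  obtain ⟨N₂, hN₂⟩ := exists_rowLen_eq_zero s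
  set N := max N₁ N₂
  have hrN : r.rowLen N = 0 := by
    have := r.rowLen_anti N₁ N (le_max_left _ _)
    omega
  have hsN : s.rowLen N = 0 := by
    have := s.rowLen_anti N₂ N (le_max_right _ _)
    omega
  have hdN : d.rowLen N = 0 := by
    have := (hd N).2
    omega
  have huN : u.rowLen (N + 1) = 0 := by
    have := (hr N).1
    omega
  have hr' : r.rowLen (N + 1) = 0 := by
    have := r.rowLen_anti N (N + 1) (Nat.le_succ _)
    omega
  have hs' : s.rowLen (N + 1) = 0 := by
    have := s.rowLen_anti N (N + 1) (Nat.le_succ _)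
    omega
  have h1 := Finset.sum_congr (rfl : Finset.range N = _) fun i _ => h i
  rw [Finset.sum_add_distrib, Finset.sum_add_distrib] at h1
  have h2 : ∑ i ∈ Finset.range (N + 1), (max (r.rowLen i) (s.rowLen i)) +
      ∑ i ∈ Finset.range N, (min (r.rowLen i) (s.rowLen i)) =
      ∑ i ∈ Finset.range N, r.rowLen i + ∑ i ∈ Finset.range N, s.rowLen i := by
    rw [Finset.sum_range_succ, hrN, hsN, max_self, add_zero, ← Finset.sum_add_distrib,
      ← Finset.sum_add_distrib]
    exact Finset.sum_congr rfl fun i _ => max_add_min _ _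
  rw [Finset.sum_range_succ'] at h2
  rw [card_cells_eq_sum d N hdN, card_cells_eq_sum u (N + 1) huN, card_cells_eq_sum r N hrN,
    card_cells_eq_sum s N hsN, Finset.sum_range_succ' (fun i => u.rowLen i)]
  omega

/-- The local rule behind the commutation of adding and removing horizontal strips: the diagrams
`u` above `r` and `s` correspond to the diagrams `d` below them by reflecting the row length
`u_{i+1}` in the interval `[max(r_{i+1}, s_{i+1}), min(r_i, s_i)]`, and the first row of `u` makes
up for the size. -/
theorem card_above_eq_card_below (r s : YoungDiagram) (m t : ℕ)
    (h : r.cells.card + m = s.cells.card + t) :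
    {u | u ∈ stripAbove r m ∧ s ∈ stripBelow u t}.ncard =
      {d | IsStrip d r ∧ IsStrip d s ∧ r.cells.card ≤ d.cells.card + t}.ncard := by
  obtain ⟨N₁, hN₁⟩ := exists_rowLen_eq_zero r
  obtain ⟨N₂, hN₂⟩ := exists_rowLen_eq_zero s
  have hanti := r.rowLen_anti
  have hanti' := s.rowLen_anti
  -- the diagram below associated with a diagram above
  have hdown : ∀ u, IsStrip r u → IsStrip s u → ∃ d, IsStrip d r ∧ IsStrip d s ∧
      ∀ i, d.rowLen i + u.rowLen (i + 1) =
        max (r.rowLen (i + 1)) (s.rowLen (i + 1)) + min (r.rowLen i) (s.rowLen i) := by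
    intro u hu hu'
    have hle : ∀ i, u.rowLen (i + 1) ≤
        max (r.rowLen (i + 1)) (s.rowLen (i + 1)) + min (r.rowLen i) (s.rowLen i) := by
      intro i
      have h1 := hu i
      have h2 := hu' i
      omega
    have hrow := rowLen_ofRows (fun i => max (r.rowLen (i + 1)) (s.rowLen (i + 1)) +
        min (r.rowLen i) (s.rowLen i) - u.rowLen (i + 1))
      (antitone_nat_of_succ_le fun i => by
        have h1 := hu i
        have h2 := hu' i
        have h3 := hu (i + 1)
        have h4 := hu' (i + 1)
        have h5 := hu (i + 1 + 1)
        have h6 := hu' (i + 1 + 1)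
        omega) (max N₁ N₂) (by
        have h1 := hanti N₁ (max N₁ N₂) (le_max_left _ _)
        have h2 := hanti' N₂ (max N₁ N₂) (le_max_right _ _)
        have h3 := hanti N₁ (max N₁ N₂ + 1) (by omega)
        have h4 := hanti' N₂ (max N₁ N₂ + 1) (by omega)
        omega)
    generalize ofRows _ _ _ _ = d at hrow
    refine ⟨d, fun i => ?_, fun i => ?_, fun i => ?_⟩ <;>
    · have h1 := hu i
      have h2 := hu' i
      have h3 := hu (i + 1)
      have h4 := hu' (i + 1)
      have h5 := hrow i
      omega
  -- the diagram above associated with a diagram below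
  have hup : ∀ d, IsStrip d r → IsStrip d s → r.cells.card ≤ d.cells.card + t →
      ∃ u, IsStrip r u ∧ IsStrip s u ∧
      u.rowLen 0 = max (r.rowLen 0) (s.rowLen 0) + (d.cells.card + t - r.cells.card) ∧
      ∀ i, d.rowLen i + u.rowLen (i + 1) =
        max (r.rowLen (i + 1)) (s.rowLen (i + 1)) + min (r.rowLen i) (s.rowLen i) := by
    intro d hd hd' hcard
    set c := d.cells.card + t - r.cells.card
    let f : ℕ → ℕ := fun i => Nat.casesOn i (max (r.rowLen 0) (s.rowLen 0) + c) fun i =>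
      max (r.rowLen (i + 1)) (s.rowLen (i + 1)) + min (r.rowLen i) (s.rowLen i) - d.rowLen i
    have hf0 : f 0 = max (r.rowLen 0) (s.rowLen 0) + c := rfl
    have hfs : ∀ i, f (i + 1) =
      max (r.rowLen (i + 1)) (s.rowLen (i + 1)) + min (r.rowLen i) (s.rowLen i) - d.rowLen i :=
      fun i => rfl
    clear_value f
    have hrow := rowLen_ofRows f
      (antitone_nat_of_succ_le fun i => by
        have h1 := hd i
        have h2 := hd' i
        cases i with
        | zero =>
          rw [hf0, hfs]
          omega
        | succ i =>
          have h3 := hd i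
          have h4 := hd' i
          rw [hfs, hfs]
          omega) (max N₁ N₂ + 1) (by
        have h1 := hanti N₁ (max N₁ N₂) (le_max_left _ _)
        have h2 := hanti' N₂ (max N₁ N₂) (le_max_right _ _)
        have h3 := hanti N₁ (max N₁ N₂ + 1) (by omega)
        have h4 := hanti' N₂ (max N₁ N₂ + 1) (by omega)
        rw [hfs]
        omega)
    generalize ofRows _ _ _ _ = u at hrow
    have hall : ∀ i, max (r.rowLen i) (s.rowLen i) ≤ u.rowLen i := by
      intro i
      rw [hrow]
      cases i with
      | zero => rw [hf0]; omega
      | succ i =>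
        have h1 := hd i
        have h2 := hd' i
        rw [hfs]
        omega
    refine ⟨u, fun i => ?_, fun i => ?_, by rw [hrow, hf0], fun i => ?_⟩ <;>
    · have h1 := hd i
      have h2 := hd' i
      have h3 := hall i
      have h4 := hrow (i + 1)
      have h5 := hfs i
      omega
  choose! D hD1 hD2 hD3 using hdown
  choose! U hU1 hU2 hU0 hU3 using hup
  refine Set.ncard_congr (fun u _ => D u) ?_ ?_ ?_
  · rintro u ⟨hu, hu'⟩
    rw [mem_stripAbove] at hu
    rw [mem_stripBelow] at hu'
    have hc := card_reflect hu.1 (hD1 u hu.1 hu'.1) (hD3 u hu.1 hu'.1)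
    have h1 := (hu.1 0).2
    have h2 := (hu'.1 0).2
    exact ⟨hD1 u hu.1 hu'.1, hD2 u hu.1 hu'.1, by omega⟩
  · rintro u v ⟨hu, hu'⟩ ⟨hv, hv'⟩ huv
    rw [mem_stripAbove] at hu hv
    rw [mem_stripBelow] at hu' hv'
    have hc := card_reflect hu.1 (hD1 u hu.1 hu'.1) (hD3 u hu.1 hu'.1)
    have hc' := card_reflect hv.1 (hD1 v hv.1 hv'.1) (hD3 v hv.1 hv'.1)
    apply ext_rowLen
    intro i
    cases i with
    | zero =>
      rw [huv] at hc
      omega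
    | succ i =>
      have h1 := hD3 u hu.1 hu'.1 i
      have h2 := hD3 v hv.1 hv'.1 i
      rw [huv] at h1
      omega
  · rintro d ⟨hd, hd', hcard⟩
    have h1 := hU1 d hd hd' hcard
    have h2 := hU2 d hd hd' hcard
    have hc := card_reflect h1 hd (hU3 d hd hd' hcard)
    have h0 := hU0 d hd hd' hcard
    refine ⟨U d, ⟨mem_stripAbove.2 ⟨h1, by omega⟩, mem_stripBelow.2 ⟨h2, by omega⟩⟩, ?_⟩
    apply ext_rowLen
    intro i
    have h3 := hD3 (U d) h1 h2 i
    have h4 := hU3 d hd hd' hcard i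
    omega

/-- Commutation of adding and removing horizontal strips, up to a correction: the ways from `r` to
`s` that add a strip of size `m` and then remove one of size `t` correspond to those that first
remove a strip of size `x ≤ t` and then add one of size `m - (t - x)`. -/
theorem card_strip_commute (r s : YoungDiagram) (m t : ℕ) :
    ((stripAbove r m).filter fun u => s ∈ stripBelow u t).card =
      ∑ x ∈ Finset.HasAntidiagonal.antidiagonal t, if x.2 ≤ m then
        ((stripBelow r x.1).filter fun d => s ∈ stripAbove d (m - x.2)).card else 0 := by
  by_cases h : r.cells.card + m = s.cells.card + t
  · have h1 := card_above_eq_card_below r s m t h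
    have hfin : {d | IsStrip d r ∧ IsStrip d s ∧ r.cells.card ≤ d.cells.card + t} =
        ((Finset.HasAntidiagonal.antidiagonal t).biUnion fun x => if x.2 ≤ m then
          ((stripBelow r x.1).filter fun d => s ∈ stripAbove d (m - x.2)) else ∅ :
          Finset YoungDiagram) := by
      ext d
      simp only [Set.mem_ofPred_eq, Finset.coe_biUnion, Set.mem_iUnion, Finset.mem_coe,
        Finset.HasAntidiagonal.mem_antidiagonal, exists_prop]
      constructor
      · rintro ⟨hd, hd', hc⟩
        have h2 := hd.card_le
        have h3 := hd'.card_le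
        refine ⟨(r.cells.card - d.cells.card, d.cells.card + t - r.cells.card), by simp only; omega,
          ?_⟩
        rw [if_pos (by simp only; omega), Finset.mem_filter, mem_stripBelow, mem_stripAbove]
        simp only
        exact ⟨⟨hd, by omega⟩, hd', by omega⟩
      · rintro ⟨⟨x, y⟩, hx, hd⟩
        simp only at hx hd
        split_ifs at hd with hy
        · rw [Finset.mem_filter, mem_stripBelow, mem_stripAbove] at hd
          exact ⟨hd.1.1, hd.2.1, by omega⟩
        · simp at hd
    have hlhs : {u | u ∈ stripAbove r m ∧ s ∈ stripBelow u t} =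
        (((stripAbove r m).filter fun u => s ∈ stripBelow u t : Finset YoungDiagram) :
          Set YoungDiagram) := by
      ext u
      simp
    rw [hfin, hlhs, Set.ncard_coe_finset, Set.ncard_coe_finset, Finset.card_biUnion] at h1
    · rw [h1]
      refine Finset.sum_congr rfl fun x _ => ?_
      split_ifs <;> simp
    · rintro ⟨x, y⟩ hx ⟨x', y'⟩ hx' hne
      rw [Function.onFun, Finset.disjoint_left]
      intro d hd hd'
      apply hne
      rw [Finset.mem_coe, Finset.HasAntidiagonal.mem_antidiagonal] at hx hx'
      simp only at hx hx' hd hd'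
      split_ifs at hd hd' with hy hy'
      · rw [Finset.mem_filter, mem_stripBelow] at hd hd'
        have := hd.1.2
        have := hd'.1.2
        rw [Prod.mk.injEq]
        omega
      all_goals simp at hd hd'
  · rw [Finset.filter_false_of_mem, Finset.card_empty, eq_comm]
    · refine Finset.sum_eq_zero fun x hx => ?_
      rw [Finset.HasAntidiagonal.mem_antidiagonal] at hx
      split_ifs with hy
      · rw [Finset.card_eq_zero, Finset.filter_eq_empty_iff]
        intro d hd hd'
        rw [mem_stripBelow] at hd
        rw [mem_stripAbove] at hd'
        omega
      · rfl
    · intro u hu hu'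
      rw [mem_stripAbove] at hu
      rw [mem_stripBelow] at hu'
      omega

/-! ### Kostka numbers -/

/-- The content of a semistandard tableau: the multiplicity of each entry. -/
def tabContent {r : YoungDiagram} (T : SemistandardYoungTableau r) : ℕ →₀ ℕ :=
  ∑ c ∈ r.cells, Finsupp.single (T c.1 c.2) 1

theorem tabContent_apply {r : YoungDiagram} (T : SemistandardYoungTableau r) (i : ℕ) :
    tabContent T i = (r.cells.filter fun c => T c.1 c.2 = i).card := by
  rw [Finset.card_filter]
  simp only [tabContent, Finsupp.finsetSum_apply, Finsupp.single_apply]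

theorem tabContent_pos {r : YoungDiagram} (T : SemistandardYoungTableau r) {i j : ℕ}
    (h : (i, j) ∈ r) : tabContent T (T i j) ≠ 0 := by
  rw [tabContent_apply]
  exact Finset.card_ne_zero_of_mem (a := (i, j)) (Finset.mem_filter.2 ⟨h, rfl⟩)

theorem kostka_eq_card (r : YoungDiagram) (d : ℕ →₀ ℕ) :
    kostka r d = Nat.card {T : SemistandardYoungTableau r // tabContent T = d} := by
  refine Nat.card_congr (Equiv.subtypeEquivRight fun T => ?_)
  rw [DFunLike.ext_iff]
  simp only [tabContent_apply]

instance (r : YoungDiagram) (d : ℕ →₀ ℕ) :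
    Finite {T : SemistandardYoungTableau r // tabContent T = d} := by
  refine Finite.of_injective (β := r.cells → d.support)
    (fun T c => ⟨T.1 c.1.1 c.1.2, ?_⟩) ?_
  · have h := tabContent_pos T.1 (i := c.1.1) (j := c.1.2) c.2
    rw [T.2] at h
    exact Finsupp.mem_support_iff.2 h
  · intro T T' h
    apply Subtype.ext
    ext i j
    by_cases hc : (i, j) ∈ r
    · exact congrArg Subtype.val (congrFun h ⟨(i, j), hc⟩)
    · rw [T.1.zeros hc, T'.1.zeros hc]

theorem exists_tableau_of_kostka_ne_zero {r : YoungDiagram} {d : ℕ →₀ ℕ} (h : kostka r d ≠ 0) :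
    ∃ T : SemistandardYoungTableau r, tabContent T = d := by
  rw [kostka_eq_card] at h
  obtain ⟨T⟩ := (Nat.card_ne_zero.1 h).1
  exact ⟨T.1, T.2⟩

theorem row_le_entry {r : YoungDiagram} (T : SemistandardYoungTableau r) (i j : ℕ)
    (h : (i, j) ∈ r) : i ≤ T i j := by
  induction i with
  | zero => exact Nat.zero_le _
  | succ i ih =>
    have h1 := ih (r.up_left_mem (Nat.le_succ i) le_rfl h)
    have h2 := T.col_strict (Nat.lt_add_one i) h
    omega

theorem degree_tabContent {r : YoungDiagram} (T : SemistandardYoungTableau r) :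
    (tabContent T).degree = r.cells.card := by
  simp [tabContent, map_sum]

theorem weight_tabContent {r : YoungDiagram} (T : SemistandardYoungTableau r) :
    weight (tabContent T) = ∑ c ∈ r.cells, T c.1 c.2 := by
  have h := weight_content fun c : r.cells => T c.1.1 c.1.2
  rw [Finset.sum_coe_sort r.cells fun c => T c.1 c.2] at h
  rw [← h, content, Finset.sum_coe_sort r.cells fun c => Finsupp.single (T c.1 c.2) 1]
  rfl

theorem degree_of_kostka_ne_zero {r : YoungDiagram} {d : ℕ →₀ ℕ} (h : kostka r d ≠ 0) :
    d.degree = r.cells.card := by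
  obtain ⟨T, rfl⟩ := exists_tableau_of_kostka_ne_zero h
  exact degree_tabContent T

theorem eq_highestWeight_of_weight_le {r : YoungDiagram} (T : SemistandardYoungTableau r)
    (h : weight (tabContent T) ≤ weight (rowContent r)) :
    T = SemistandardYoungTableau.highestWeight r := by
  rw [weight_tabContent, weight_rowContent] at h
  have hle : ∀ c ∈ r.cells, c.1 ≤ T c.1 c.2 := fun c hc => row_le_entry T c.1 c.2 hc
  have heq := (Finset.sum_eq_sum_iff_of_le hle).1 (le_antisymm (Finset.sum_le_sum hle) h)
  ext i j
  rw [SemistandardYoungTableau.highestWeight_apply]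
  split_ifs with hc
  · exact (heq (i, j) hc).symm
  · exact T.zeros hc

theorem tabContent_highestWeight (r : YoungDiagram) :
    tabContent (SemistandardYoungTableau.highestWeight r) = rowContent r := by
  refine Finset.sum_congr rfl fun c hc => ?_
  rw [SemistandardYoungTableau.highestWeight_apply,
    if_pos (show (c.1, c.2) ∈ r from (YoungDiagram.mem_cells c).1 hc)]

theorem kostka_self (r : YoungDiagram) : kostka r (rowContent r) = 1 := by
  rw [kostka_eq_card, Nat.card_eq_one_iff_unique]
  refine ⟨⟨fun T T' => Subtype.ext ?_⟩, ⟨_, tabContent_highestWeight r⟩⟩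
  rw [eq_highestWeight_of_weight_le T.1 (by rw [T.2]),
    eq_highestWeight_of_weight_le T'.1 (by rw [T'.2])]

theorem kostka_eq_zero {r : YoungDiagram} {d : ℕ →₀ ℕ} (hd : d ≠ rowContent r)
    (hw : weight d ≤ weight (rowContent r)) : kostka r d = 0 := by
  by_contra h
  obtain ⟨T, rfl⟩ := exists_tableau_of_kostka_ne_zero h
  apply hd
  rw [eq_highestWeight_of_weight_le T hw, tabContent_highestWeight]

theorem colLen_le_of_kostka_ne_zero {r : YoungDiagram} {d : ℕ →₀ ℕ} (h : kostka r d ≠ 0) {l : ℕ}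
    (hd : ∀ i, l ≤ i → d i = 0) : r.colLen 0 ≤ l := by
  obtain ⟨T, rfl⟩ := exists_tableau_of_kostka_ne_zero h
  by_contra hl
  have hc : (l, 0) ∈ r := YoungDiagram.mem_iff_lt_colLen.2 (not_le.1 hl)
  exact tabContent_pos T hc (hd _ (row_le_entry T l 0 hc))

/-- A horizontal strip has at most one cell in each column. -/
theorem isStrip_iff {r s : YoungDiagram} :
    IsStrip r s ↔ r ≤ s ∧ ∀ i j, (i + 1, j) ∈ s → (i, j) ∈ r := by
  constructor
  · refine fun h => ⟨h.le, fun i j hc => ?_⟩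
    rw [YoungDiagram.mem_iff_lt_rowLen] at hc ⊢
    exact hc.trans_le (h i).1
  · rintro ⟨h1, h2⟩ i
    constructor
    · by_contra hlt
      have h3 := h2 i (r.rowLen i) (YoungDiagram.mem_iff_lt_rowLen.2 (not_le.1 hlt))
      exact (YoungDiagram.mem_iff_lt_rowLen.1 h3).false
    · by_contra hlt
      have h3 := h1 (YoungDiagram.mem_iff_lt_rowLen.2 (not_le.1 hlt))
      exact (YoungDiagram.mem_iff_lt_rowLen.1 h3).false

/-- The cells of a tableau with entry less than `k`. -/
def subDiagram {s : YoungDiagram} (T : SemistandardYoungTableau s) (k : ℕ) : YoungDiagram where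
  cells := s.cells.filter fun c => T c.1 c.2 < k
  isLowerSet := by
    rintro ⟨i, j⟩ ⟨i', j'⟩ ⟨hi, hj⟩ h
    simp only [Finset.coe_filter, Set.mem_ofPred_eq, YoungDiagram.mem_cells] at h ⊢
    simp only at hi hj
    have h1 : (i', j) ∈ s := s.up_left_mem hi le_rfl h.1
    exact ⟨s.up_left_mem hi hj h.1,
      ((T.row_weak_of_le hj h1).trans (T.col_weak hi h.1)).trans_lt h.2⟩

theorem mem_subDiagram {s : YoungDiagram} {T : SemistandardYoungTableau s} {k i j : ℕ} :
    (i, j) ∈ subDiagram T k ↔ (i, j) ∈ s ∧ T i j < k := by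
  rw [← YoungDiagram.mem_cells, subDiagram, Finset.mem_filter, YoungDiagram.mem_cells]

/-- The restriction of a tableau to a smaller diagram. -/
def restrictTableau {r s : YoungDiagram} (T : SemistandardYoungTableau s) (h : r ≤ s) :
    SemistandardYoungTableau r where
  entry i j := if (i, j) ∈ r then T i j else 0
  row_weak' {i j1 j2} hj hc := by
    rw [if_pos (r.up_left_mem le_rfl hj.le hc), if_pos hc]
    exact T.row_weak hj (h hc)
  col_strict' {i1 i2 j} hi hc := by
    rw [if_pos (r.up_left_mem hi.le le_rfl hc), if_pos hc]
    exact T.col_strict hi (h hc)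
  zeros' hc := if_neg hc

theorem restrictTableau_apply {r s : YoungDiagram} (T : SemistandardYoungTableau s) (h : r ≤ s)
    (i j : ℕ) : restrictTableau T h i j = if (i, j) ∈ r then T i j else 0 := rfl

/-- The extension of a tableau with entries less than `k` by entries `k` in a horizontal strip. -/
def extendTableau {r s : YoungDiagram} (T : SemistandardYoungTableau r) (h : IsStrip r s) (k : ℕ)
    (hk : ∀ i j, (i, j) ∈ r → T i j < k) : SemistandardYoungTableau s where
  entry i j := if (i, j) ∈ r then T i j else if (i, j) ∈ s then k else 0
  row_weak' {i j1 j2} hj hc := by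
    by_cases h2 : (i, j2) ∈ r
    · rw [if_pos (r.up_left_mem le_rfl hj.le h2), if_pos h2]
      exact T.row_weak hj h2
    · rw [if_neg h2, if_pos hc]
      split_ifs with h1 h3
      · exact (hk _ _ h1).le
      · exact le_rfl
      · exact Nat.zero_le _
  col_strict' {i1 i2 j} hi hc := by
    obtain ⟨i, rfl⟩ : ∃ i, i2 = i + 1 := ⟨i2 - 1, by omega⟩
    have h1 : (i1, j) ∈ r :=
      r.up_left_mem (Nat.lt_succ_iff.1 hi) le_rfl ((isStrip_iff.1 h).2 i j hc)
    rw [if_pos h1]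
    split_ifs with h2
    · exact T.col_strict hi h2
    · exact hk _ _ h1
  zeros' {i j} hc := by
    rw [if_neg (fun h1 => hc (h.le h1)), if_neg hc]

theorem extendTableau_apply {r s : YoungDiagram} (T : SemistandardYoungTableau r)
    (h : IsStrip r s) (k : ℕ) (hk : ∀ i j, (i, j) ∈ r → T i j < k) (i j : ℕ) :
    extendTableau T h k hk i j = if (i, j) ∈ r then T i j else if (i, j) ∈ s then k else 0 := rfl

theorem tabContent_eq_add {r s : YoungDiagram} (T : SemistandardYoungTableau r)
    (X : SemistandardYoungTableau s) (k : ℕ) (h : r ≤ s)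
    (h1 : ∀ i j, (i, j) ∈ r → X i j = T i j) (h2 : ∀ i j, (i, j) ∈ s → (i, j) ∉ r → X i j = k) :
    tabContent X = tabContent T + Finsupp.single k (s.cells.card - r.cells.card) := by
  have hsub := YoungDiagram.cells_subset_iff.2 h
  rw [tabContent, ← Finset.sum_sdiff hsub, add_comm, tabContent]
  congr 1
  · exact Finset.sum_congr rfl fun c hc => by rw [h1 c.1 c.2 hc]
  · rw [Finset.sum_congr rfl fun c hc => by
      rw [h2 c.1 c.2 (Finset.mem_sdiff.1 hc).1 (Finset.mem_sdiff.1 hc).2], Finset.sum_const,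
      Finset.card_sdiff_of_subset hsub]
    simp

/-- Removing the largest entry `k` from semistandard tableaux: its cells form a horizontal strip. -/
theorem kostka_add_single (s : YoungDiagram) (d : ℕ →₀ ℕ) (k m : ℕ)
    (hd : ∀ i ∈ d.support, i < k) :
    kostka s (d + Finsupp.single k m) = ∑ r ∈ stripBelow s m, kostka r d := by
  classical
  have hdk : d k = 0 := Finsupp.notMem_support_iff.1 fun h => (hd k h).false
  have hdge : ∀ i, k < i → (d + Finsupp.single k m) i = 0 := by
    intro i hi
    rw [Finsupp.add_apply, Finsupp.single_eq_of_ne hi.ne', add_zero]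
    exact Finsupp.notMem_support_iff.1 fun h => (hd i h).asymm hi
  -- the entries of a tableau of content `d + k^m` outside its subdiagram are `k`
  have hk : ∀ X : SemistandardYoungTableau s, tabContent X = d + Finsupp.single k m →
      ∀ i j, (i, j) ∈ s → (i, j) ∉ subDiagram X k → X i j = k := by
    intro X hX i j hc hc'
    rw [mem_subDiagram, not_and, not_lt] at hc'
    refine le_antisymm ?_ (hc' hc)
    by_contra hlt
    have h1 := tabContent_pos X hc
    rw [hX] at h1
    exact h1 (hdge _ (not_le.1 hlt))
  have hsub : ∀ X : SemistandardYoungTableau s, subDiagram X k ≤ s :=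
    fun X c hc => (mem_subDiagram.1 hc).1
  have hres : ∀ X : SemistandardYoungTableau s, tabContent X = d + Finsupp.single k m →
      tabContent (restrictTableau X (hsub X)) = d ∧
        (subDiagram X k).cells.card + m = s.cells.card := by
    intro X hX
    have h1 := tabContent_eq_add (restrictTableau X (hsub X)) X k (hsub X)
      (fun i j hc => by rw [restrictTableau_apply, if_pos hc]) (hk X hX)
    rw [hX] at h1
    have h2 : tabContent (restrictTableau X (hsub X)) k = 0 := by
      rw [tabContent_apply, Finset.card_eq_zero, Finset.filter_eq_empty_iff]
      rintro ⟨i, j⟩ hc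
      rw [YoungDiagram.mem_cells] at hc
      rw [restrictTableau_apply, if_pos hc]
      exact (mem_subDiagram.1 hc).2.ne
    have h3 := DFunLike.congr_fun h1 k
    rw [Finsupp.add_apply, Finsupp.add_apply, h2, hdk, Finsupp.single_eq_same,
      Finsupp.single_eq_same, zero_add, zero_add] at h3
    have h4 := Finset.card_le_card (YoungDiagram.cells_subset_iff.2 (hsub X))
    rw [← h3] at h1
    exact ⟨(add_right_cancel h1).symm, by omega⟩
  have hstrip : ∀ X : SemistandardYoungTableau s, tabContent X = d + Finsupp.single k m →
      subDiagram X k ∈ stripBelow s m := by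
    intro X hX
    refine mem_stripBelow.2 ⟨isStrip_iff.2 ⟨hsub X, fun i j hc => ?_⟩, (hres X hX).2⟩
    have h1 := X.col_strict (Nat.lt_succ_self i) hc
    refine mem_subDiagram.2 ⟨s.up_left_mem (Nat.le_succ i) le_rfl hc, ?_⟩
    refine h1.trans_le ?_
    by_contra hlt
    have h2 := tabContent_pos X hc
    rw [hX] at h2
    exact h2 (hdge _ (not_le.1 hlt))
  have := Fintype.ofFinite {X : SemistandardYoungTableau s //
    tabContent X = d + Finsupp.single k m}
  rw [kostka_eq_card, Nat.card_eq_fintype_card, ← Finset.card_univ,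
    Finset.card_eq_sum_card_fiberwise (f := fun X => subDiagram X.1 k) (t := stripBelow s m)
      (fun X _ => hstrip X.1 X.2)]
  refine Finset.sum_congr rfl fun r hr => ?_
  rw [mem_stripBelow] at hr
  have hlt : ∀ T : {T : SemistandardYoungTableau r // tabContent T = d},
      ∀ i j, (i, j) ∈ r → T.1 i j < k := by
    intro T i j hc
    have h1 := tabContent_pos T.1 hc
    rw [T.2] at h1
    exact hd _ (Finsupp.mem_support_iff.2 h1)
  have := Fintype.ofFinite {T : SemistandardYoungTableau r // tabContent T = d}
  rw [kostka_eq_card, Nat.card_eq_fintype_card, ← Finset.card_univ, eq_comm]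
  refine Finset.card_bij
    (fun T _ => ⟨extendTableau T.1 hr.1 k (hlt T), ?_⟩) ?_ ?_ ?_
  · rw [tabContent_eq_add T.1 (extendTableau T.1 hr.1 k (hlt T)) k hr.1.le, T.2]
    · congr 2
      omega
    · intro i j hc
      rw [extendTableau_apply, if_pos hc]
    · intro i j hc hc'
      rw [extendTableau_apply, if_neg hc', if_pos hc]
  · intro T _
    rw [Finset.mem_filter]
    refine ⟨Finset.mem_univ _, ?_⟩
    ext ⟨i, j⟩
    rw [YoungDiagram.mem_cells, YoungDiagram.mem_cells, mem_subDiagram]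
    rw [extendTableau_apply]
    constructor
    · rintro ⟨h1, h2⟩
      by_contra hc
      rw [if_neg hc, if_pos h1] at h2
      exact h2.false
    · intro hc
      rw [if_pos hc]
      exact ⟨hr.1.le hc, hlt T i j hc⟩
  · intro T _ T' _ h
    have h1 := congrArg Subtype.val h
    apply Subtype.ext
    ext i j
    by_cases hc : (i, j) ∈ r
    · have h2 := congrArg (fun Y : SemistandardYoungTableau s => Y i j) h1
      simp only [extendTableau_apply, if_pos hc] at h2
      exact h2
    · rw [T.1.zeros hc, T'.1.zeros hc]
  · intro X hX
    obtain ⟨X, hXc⟩ := X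
    obtain rfl := (Finset.mem_filter.1 hX).2
    refine ⟨⟨restrictTableau X (hsub X), (hres X hXc).1⟩, Finset.mem_univ _, ?_⟩
    apply Subtype.ext
    ext i j
    rw [extendTableau_apply, restrictTableau_apply]
    by_cases h1 : (i, j) ∈ subDiagram X k
    · rw [if_pos h1, if_pos h1]
    · rw [if_neg h1]
      split_ifs with h2
      · exact (hk X hXc i j h2 h1).symm
      · exact (X.zeros h2).symm

/-! ### The Pieri rule -/

/-- The complete homogeneous symmetric function: the sum of all monomials of degree `m`. -/
def homog (m : ℕ) : MvPowerSeries ℕ ℤ := fun d => if d.degree = m then 1 else 0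

theorem coeff_homog (m : ℕ) (d : ℕ →₀ ℕ) :
    MvPowerSeries.coeff d (homog m) = if d.degree = m then 1 else 0 := rfl

theorem coeff_schur (r : YoungDiagram) (d : ℕ →₀ ℕ) :
    MvPowerSeries.coeff d (schur r) = kostka r d := rfl

theorem sum_antidiagonal_add_single {M : Type*} [AddCommMonoid M] (a : ℕ →₀ ℕ) (k t : ℕ)
    (hk : a k = 0) (f : (ℕ →₀ ℕ) → (ℕ →₀ ℕ) → M) :
    ∑ x ∈ Finset.HasAntidiagonal.antidiagonal (a + Finsupp.single k t), f x.1 x.2 =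
      ∑ u ∈ Finset.HasAntidiagonal.antidiagonal t, ∑ x ∈ Finset.HasAntidiagonal.antidiagonal a,
        f (x.1 + Finsupp.single k u.1) (x.2 + Finsupp.single k u.2) := by
  rw [← Finset.sum_product']
  symm
  refine Finset.sum_bij' (fun y _ => (y.2.1 + Finsupp.single k y.1.1,
    y.2.2 + Finsupp.single k y.1.2)) (fun x _ => ((x.1 k, x.2 k), (x.1.erase k, x.2.erase k)))
    ?_ ?_ ?_ ?_ ?_
  · rintro ⟨⟨u, v⟩, p, q⟩ h
    simp only [Finset.mem_product, Finset.HasAntidiagonal.mem_antidiagonal] at h ⊢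
    rw [← h.1, ← h.2, Finsupp.single_add, add_add_add_comm]
  · rintro ⟨p, q⟩ h
    simp only [Finset.mem_product, Finset.HasAntidiagonal.mem_antidiagonal] at h ⊢
    constructor
    · rw [← Finsupp.add_apply, h]
      simp [hk]
    · rw [← Finsupp.erase_add, h, Finsupp.erase_add, Finsupp.erase_single, add_zero,
        Finsupp.erase_of_notMem_support (Finsupp.notMem_support_iff.2 hk)]
  · rintro ⟨⟨u, v⟩, p, q⟩ h
    simp only [Finset.mem_product, Finset.HasAntidiagonal.mem_antidiagonal] at h
    have h1 := DFunLike.congr_fun h.2 k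
    rw [Finsupp.add_apply, hk] at h1
    have hp : p k = 0 := by omega
    have hq : q k = 0 := by omega
    simp [hp, hq, Finsupp.erase_add]
  · rintro ⟨p, q⟩ _
    simp [Finsupp.erase_add_single]
  · rintro ⟨⟨u, v⟩, p, q⟩ _
    rfl

theorem stripAbove_zero (r : YoungDiagram) : stripAbove r 0 = {r} := by
  ext s
  rw [mem_stripAbove, Finset.mem_singleton]
  constructor
  · rintro ⟨h, hc⟩
    have h1 := Finset.eq_of_subset_of_card_le (YoungDiagram.cells_subset_iff.2 h.le)
      (by omega)
    exact (YoungDiagram.ext h1).symm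
  · rintro rfl
    exact ⟨fun i => ⟨s.rowLen_anti _ _ (Nat.le_succ i), le_rfl⟩, rfl⟩

/-- Double counting: the elements `x` of the sets `t i` are collected with their multiplicities. -/
theorem sum_sum_eq_sum_card {ι κ : Type*} [DecidableEq κ] (s : Finset ι) (t : ι → Finset κ)
    (X : Finset κ) (hX : ∀ i ∈ s, t i ⊆ X) (f : κ → ℤ) :
    ∑ i ∈ s, ∑ x ∈ t i, f x = ∑ x ∈ X, ((s.filter fun i => x ∈ t i).card : ℤ) * f x := by
  have h : ∀ i ∈ s, ∑ x ∈ t i, f x = ∑ x ∈ X, if x ∈ t i then f x else 0 := by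
    intro i hi
    rw [← Finset.sum_filter, Finset.filter_mem_eq_inter, Finset.inter_eq_right.2 (hX i hi)]
  rw [Finset.sum_congr rfl h, Finset.sum_comm]
  refine Finset.sum_congr rfl fun x _ => ?_
  rw [← Finset.sum_filter, Finset.sum_const, nsmul_eq_mul]

/-- The Pieri rule, by induction on the monomial: the largest letter is removed on both sides, and
the strips commute. -/
theorem schur_mul_homog (r : YoungDiagram) (m : ℕ) :
    schur r * homog m = ∑ s ∈ stripAbove r m, schur s := by
  ext a
  rw [map_sum]
  simp only [coeff_schur]
  induction a using Finsupp.induction_on_max₂ generalizing r m with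
  | zero =>
    rw [MvPowerSeries.coeff_mul, Finset.HasAntidiagonal.antidiagonal_zero, Finset.sum_singleton,
      coeff_schur, coeff_homog, map_zero]
    split_ifs with hm
    · rw [← hm, stripAbove_zero, Finset.sum_singleton, mul_one]
    · rw [mul_zero, eq_comm]
      refine Finset.sum_eq_zero fun s hs => ?_
      by_contra h
      have h1 := degree_of_kostka_ne_zero (fun h2 => h (by rw [h2, Nat.cast_zero]))
      rw [map_zero, ← (mem_stripAbove.1 hs).2] at h1
      omega
  | add_single k t a ha ht ih =>
    have hak : a k = 0 := Finsupp.notMem_support_iff.1 fun h => (ha k h).false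
    rw [MvPowerSeries.coeff_mul, sum_antidiagonal_add_single a k t hak
      fun p q => MvPowerSeries.coeff p (schur r) * MvPowerSeries.coeff q (homog m)]
    -- of the `t` letters `k`, `u.1` belong to the tableau and `u.2` to the factor `h_m`
    have hleft : ∀ u ∈ Finset.HasAntidiagonal.antidiagonal t,
        ∑ x ∈ Finset.HasAntidiagonal.antidiagonal a,
          MvPowerSeries.coeff (x.1 + Finsupp.single k u.1) (schur r) *
            MvPowerSeries.coeff (x.2 + Finsupp.single k u.2) (homog m) =
          if u.2 ≤ m then ∑ d ∈ stripBelow r u.1, ∑ s ∈ stripAbove d (m - u.2), (kostka s a : ℤ)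
          else 0 := by
      intro u _
      split_ifs with hu
      · simp only [← ih]
        simp only [MvPowerSeries.coeff_mul]
        rw [Finset.sum_comm]
        refine Finset.sum_congr rfl fun x hx => ?_
        rw [Finset.HasAntidiagonal.mem_antidiagonal] at hx
        have hx' : ∀ i ∈ x.1.support, i < k := by
          intro i hi
          apply ha
          rw [Finsupp.mem_support_iff] at hi ⊢
          rw [← hx, Finsupp.add_apply]
          omega
        rw [coeff_schur, kostka_add_single r x.1 k u.1 hx', ← Finset.sum_mul, coeff_homog,
          coeff_homog, map_add, Finsupp.degree_single, Nat.cast_sum]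
        simp only [coeff_schur]
        congr 1
        refine if_congr ?_ rfl rfl
        omega
      · refine Finset.sum_eq_zero fun x _ => ?_
        rw [coeff_homog, if_neg, mul_zero]
        rw [map_add, Finsupp.degree_single]
        omega
    rw [Finset.sum_congr rfl hleft]
    simp only [kostka_add_single _ a k t ha, Nat.cast_sum]
    set X : Finset YoungDiagram := diagrams (r.cells.card + m - t) with hX
    rw [sum_sum_eq_sum_card (stripAbove r m) (fun s => stripBelow s t) X
      (fun s hs x hx => mem_diagrams.2 (by
        rw [mem_stripAbove] at hs
        rw [mem_stripBelow] at hx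
        omega)) fun s => (kostka s a : ℤ)]
    simp only [card_strip_commute, Nat.cast_sum, Finset.sum_mul]
    rw [Finset.sum_comm]
    refine Finset.sum_congr rfl fun u hu => ?_
    rw [Finset.HasAntidiagonal.mem_antidiagonal] at hu
    split_ifs with hum
    · rw [sum_sum_eq_sum_card (stripBelow r u.1) (fun d => stripAbove d (m - u.2)) X
        (fun s hs x hx => mem_diagrams.2 (by
          rw [mem_stripBelow] at hs
          rw [mem_stripAbove] at hx
          omega)) fun s => (kostka s a : ℤ)]
    · simp

theorem schur_bot : schur ⊥ = 1 := by
  ext d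
  rw [coeff_schur, MvPowerSeries.coeff_one]
  have h0 : rowContent ⊥ = 0 := by simp [rowContent]
  split_ifs with h
  · rw [h, ← h0, kostka_self, Nat.cast_one]
  · rw [Nat.cast_eq_zero]
    by_contra hne
    have h1 := degree_of_kostka_ne_zero hne
    rw [YoungDiagram.cells_bot, Finset.card_empty, Finsupp.degree_eq_zero_iff] at h1
    exact h h1

/-- Products of complete homogeneous symmetric functions in terms of Schur functions. -/
theorem prod_homog : ∀ {k : ℕ} (a : Fin k → ℕ),
    ∏ i, homog (a i) = ∑ r ∈ diagrams (∑ i, a i), (kostka r (expo a) : ℤ) • schur r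
  | 0, a => by
    have h0 : diagrams 0 = {⊥} := by
      ext r
      rw [mem_diagrams, Finset.mem_singleton, Finset.card_eq_zero]
      exact ⟨fun h => YoungDiagram.ext h, fun h => h ▸ rfl⟩
    have h1 : expo a = rowContent ⊥ := by simp [expo_eq_sum, rowContent]
    rw [Fin.prod_univ_zero, Fin.sum_univ_zero, h0, Finset.sum_singleton, schur_bot, h1,
      kostka_self, Nat.cast_one, one_smul]
  | k + 1, a => by
    have he : expo a = expo (fun i : Fin k => a i.castSucc) +
        Finsupp.single k (a (Fin.last k)) := by
      rw [expo_eq_sum, expo_eq_sum, Fin.sum_univ_castSucc]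
      simp
    have hd : ∀ i ∈ (expo fun i : Fin k => a i.castSucc).support, i < k := by
      intro i hi
      rw [expo_eq_sum, Finsupp.mem_support_iff, Finsupp.finsetSum_apply] at hi
      obtain ⟨j, _, hj⟩ := Finset.exists_ne_zero_of_sum_ne_zero hi
      rw [Finsupp.single_apply_ne_zero] at hj
      rw [hj.1]
      exact j.2
    rw [Fin.prod_univ_castSucc, prod_homog, Finset.sum_mul, Fin.sum_univ_castSucc, he]
    simp only [smul_mul_assoc, schur_mul_homog, kostka_add_single _ _ k _ hd, Nat.cast_sum,
      Finset.sum_smul, Finset.smul_sum]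
    refine Finset.sum_comm' fun r s => ?_
    rw [mem_diagrams, mem_diagrams, mem_stripAbove, mem_stripBelow]
    constructor
    · rintro ⟨h1, h2, h3⟩
      exact ⟨⟨h2, h3⟩, by omega⟩
    · rintro ⟨⟨h1, h2⟩, h3⟩
      exact ⟨by omega, h1, h2⟩

/-- The Cauchy identity: the nonnegative integer matrices with given row and column sums are
counted by pairs of semistandard tableaux of the same shape. -/
theorem sum_kostka_mul_kostka {k n : ℕ} (a : Fin k → ℕ) (h : ∑ i, a i = n) (b : ℕ →₀ ℕ) :
    ∑ p : n.Partition, (kostka (diagram p) (expo a) : ℤ) * kostka (diagram p) b =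
      (((Finset.finsuppAntidiag (Finset.univ : Finset (Fin k)) b).filter
        fun A => ∀ i, (A i).degree = a i).card : ℤ) := by
  classical
  have h1 := congrArg (MvPowerSeries.coeff b) (prod_homog a)
  rw [MvPowerSeries.coeff_prod, map_sum, h, diagrams, Finset.sum_map] at h1
  simp only [Function.Embedding.coeFn_mk, map_zsmul, coeff_schur, smul_eq_mul] at h1
  rw [← h1, Finset.card_filter, Nat.cast_sum]
  refine Finset.sum_congr rfl fun A _ => ?_
  simp only [coeff_homog]
  rw [Finset.prod_ite_zero]
  simp

/-! ### Young's rule -/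

theorem exists_expo_eq (d : ℕ →₀ ℕ) : ∃ (k : ℕ) (a : Fin k → ℕ), expo a = d := by
  obtain ⟨k, hk⟩ := d.support.exists_nat_subset_range
  refine ⟨k, fun i => d i, ?_⟩
  ext i
  rw [expo_eq_sum, Finsupp.finsetSum_apply]
  simp only [Finsupp.single_apply]
  by_cases hi : i < k
  · rw [Finset.sum_eq_single (⟨i, hi⟩ : Fin k)]
    · simp
    · intro j _ hj
      rw [if_neg fun h => hj (Fin.ext h)]
    · simp
  · rw [Finset.sum_eq_zero fun (j : Fin k) _ =>
      if_neg fun h : (j : ℕ) = i => hi (h ▸ j.2), eq_comm]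
    exact Finsupp.notMem_support_iff.1 fun h => hi (Finset.mem_range.1 (hk h))

/-- Young's rule: the multiplicities of the Specht modules in the permutation modules are the
Kostka numbers. Both families of numbers are unitriangular with respect to the weight, and both
factor the matrix of pairings of permutation characters, so that they agree. -/
theorem pairing_chi_permChar {n : ℕ} (p : n.Partition) (b : ℕ →₀ ℕ) :
    pairing (chi p) (permChar b) = kostka (diagram p) b := by
  classical
  induction hw : weight (rowContent (diagram p)) using Nat.strong_induction_on
    generalizing p b with
  | _ w ih =>
    subst hw
    obtain ⟨k, a, ha⟩ := exists_expo_eq (rowContent (diagram p))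
    have hsum : ∑ i, a i = n := by
      rw [← degree_expo, ha, degree_rowContent, card_diagram]
    have h1 := pairing_permChar_permChar b hsum
    have h2 := congrArg (Int.cast (R := ℂ)) (sum_kostka_mul_kostka a hsum b)
    rw [pairing_eq_sum _ _ (permChar_conj _)] at h1
    push_cast at h2
    rw [← h2, ha, ← Finset.add_sum_erase _ _ (Finset.mem_univ p),
      ← Finset.add_sum_erase _ _ (Finset.mem_univ p), pairing_chi_permChar_self, kostka_self] at h1
    have h3 : ∀ s ∈ Finset.univ.erase p,
        pairing (chi s) (permChar b) * pairing (chi s) (permChar (rowContent (diagram p))) =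
          (kostka (diagram s) (rowContent (diagram p)) : ℂ) * kostka (diagram s) b := by
      intro s hs
      rcases lt_or_ge (weight (rowContent (diagram s))) (weight (rowContent (diagram p))) with h | h
      · rw [ih _ h s b rfl, ih _ h s _ rfl, mul_comm]
      · have hne : rowContent (diagram p) ≠ rowContent (diagram s) := fun heq =>
          (Finset.mem_erase.1 hs).1 (diagram_injective (rowContent_injective heq)).symm
        rw [pairing_chi_permChar_eq_zero s hne h, kostka_eq_zero hne h]
        simp
    rw [Finset.sum_congr rfl h3] at h1
    simpa using h1

/-! ### Schur expansions -/

/-- Kostka numbers are unitriangular: the shape of least weight in a linear combination survives in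
the coefficient at its own row lengths. -/
theorem schur_linearIndependent : LinearIndependent ℤ schur := by
  rw [linearIndependent_iff]
  intro l hl
  by_contra hne
  obtain ⟨r, hr, hmin⟩ := Finset.exists_min_image l.support
    (fun r => weight (rowContent r)) (Finsupp.support_nonempty_iff.2 hne)
  have h := congrArg (MvPowerSeries.coeff (rowContent r)) hl
  rw [Finsupp.linearCombination_apply, Finsupp.sum, map_sum, map_zero,
    Finset.sum_eq_single_of_mem r hr] at h
  · rw [map_zsmul, coeff_schur, kostka_self, Nat.cast_one, smul_eq_mul, mul_one] at h
    exact Finsupp.mem_support_iff.1 hr h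
  · intro s hs hsr
    rw [map_zsmul, coeff_schur, kostka_eq_zero (fun h => hsr (rowContent_injective h).symm)
      (hmin s hs), Nat.cast_zero, smul_zero]

theorem schurExpansion_linearCombination (c : YoungDiagram →₀ ℤ) :
    schurExpansion (Finsupp.linearCombination ℤ schur c) = c := by
  have h : ∃ c', Finsupp.linearCombination ℤ schur c' = Finsupp.linearCombination ℤ schur c :=
    ⟨c, rfl⟩
  rw [schurExpansion, dif_pos h]
  exact schur_linearIndependent h.choose_spec

theorem hallInner_schur_sum {m : ℕ} (r : YoungDiagram) (z : m.Partition → ℤ) :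
    hallInner (schur r) (∑ p, z p • schur (diagram p)) =
      ∑ p, if diagram p = r then z p else 0 := by
  have h1 : ∑ p, z p • schur (diagram p) =
      Finsupp.linearCombination ℤ schur (∑ p, Finsupp.single (diagram p) (z p)) := by
    simp [map_sum]
  have h2 : schur r = Finsupp.linearCombination ℤ schur (Finsupp.single r 1) := by simp
  rw [hallInner, h1, schurExpansion_linearCombination, h2, schurExpansion_linearCombination,
    Finsupp.sum_single_index (by simp), one_mul, Finsupp.finsetSum_apply]
  simp only [Finsupp.single_apply]

/-! ### Littlewood-Richardson coefficients as restriction multiplicities -/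

section LR

variable {k n : ℕ} {a : Fin k → ℕ}

/-- Both sides are the multiplicity of the external product of the Specht modules in the restriction
of the permutation module `M^b` to a Young subgroup. -/
theorem coeff_prod_schur (α : ∀ i, (a i).Partition) (e : (Σ i, Fin (a i)) ≃ Fin n) (b : ℕ →₀ ℕ) :
    ((MvPowerSeries.coeff b (∏ i, schur (diagram (α i))) : ℤ) : ℂ) =
      ∑ p : n.Partition, (kostka (diagram p) b : ℂ) *
        pairing (chiProd α) (fun h => chi p (youngEmb e h)) := by
  classical
  have h1 : ∀ h, permChar b (youngEmb e h) =
      ∑ p : n.Partition, (kostka (diagram p) b : ℂ) * chi p (youngEmb e h) := by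
    intro h
    rw [eq_sum_chi _ (permChar_conj b)]
    simp only [pairing_chi_permChar]
  rw [← pairing_sum_right, ← funext h1, MvPowerSeries.coeff_prod]
  simp only [permChar_youngEmb]
  have h2 := pairing_sum_right (Finset.finsuppAntidiag (Finset.univ : Finset (Fin k)) b)
    (chiProd α) (fun _ => 1) (fun A h => ∏ i, permChar (A i) (h i))
  simp only [one_mul] at h2
  rw [h2]
  push_cast
  refine Finset.sum_congr rfl fun A _ => ?_
  simp only [coeff_schur, Int.cast_natCast]
  have h3 := pairing_prod (fun i => chi (α i)) (fun i => permChar (A i))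
  simp only [pairing_chi_permChar] at h3
  exact h3.symm

/-- Integrality follows by triangularity: the coefficients of the product of Schur functions are
integers. -/
theorem exists_int_pairing_chiProd (α : ∀ i, (a i).Partition) (e : (Σ i, Fin (a i)) ≃ Fin n)
    (p : n.Partition) :
    ∃ z : ℤ, pairing (chiProd α) (fun h => chi p (youngEmb e h)) = z := by
  classical
  induction hw : weight (rowContent (diagram p)) using Nat.strong_induction_on
    generalizing p with
  | _ w ih =>
    subst hw
    have h1 := coeff_prod_schur α e (rowContent (diagram p))
    rw [← Finset.add_sum_erase _ _ (Finset.mem_univ p), kostka_self, Nat.cast_one, one_mul] at h1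
    have h2 : ∀ s ∈ Finset.univ.erase p, ∃ z : ℤ,
        (kostka (diagram s) (rowContent (diagram p)) : ℂ) *
          pairing (chiProd α) (fun h => chi s (youngEmb e h)) = z := by
      intro s hs
      rcases lt_or_ge (weight (rowContent (diagram s))) (weight (rowContent (diagram p))) with h | h
      · obtain ⟨z, hz⟩ := ih _ h s rfl
        exact ⟨kostka (diagram s) (rowContent (diagram p)) * z, by rw [hz]; push_cast; rfl⟩
      · have hne : rowContent (diagram p) ≠ rowContent (diagram s) := fun heq =>
          (Finset.mem_erase.1 hs).1 (diagram_injective (rowContent_injective heq)).symm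
        exact ⟨0, by rw [kostka_eq_zero hne h]; simp⟩
    choose! z hz using h2
    rw [Finset.sum_congr rfl hz, ← Int.cast_sum] at h1
    exact ⟨_, (eq_sub_of_add_eq h1.symm).trans (Int.cast_sub _ _).symm⟩

/-- The Schur expansion of a product of Schur functions has nonnegative coefficients, the
multiplicities of the external products of Specht modules in the restrictions. -/
theorem exists_prod_schur_eq (α : ∀ i, (a i).Partition) (e : (Σ i, Fin (a i)) ≃ Fin n) :
    ∃ z : n.Partition → ℤ, ∏ i, schur (diagram (α i)) = ∑ p, z p • schur (diagram p) ∧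
      ∀ p, 0 ≤ z p ∧ pairing (chiProd α) (fun h => chi p (youngEmb e h)) = z p := by
  choose z hz using exists_int_pairing_chiProd α e
  refine ⟨z, ?_, fun p => ⟨?_, hz p⟩⟩
  · ext b
    apply Int.cast_injective (α := ℂ)
    rw [coeff_prod_schur α e, map_sum]
    push_cast
    refine Finset.sum_congr rfl fun p _ => ?_
    rw [hz, map_zsmul, coeff_schur, smul_eq_mul]
    push_cast
    rw [mul_comm]
  · obtain ⟨t, ht, h⟩ := pairing_chiProd_nonneg α e p
    rw [hz] at h
    have h' : (z p : ℝ) = t := by exact_mod_cast h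
    exact_mod_cast h'.symm ▸ ht

theorem multiLR_of_prod_eq {m : ℕ} (p : n.Partition) (α : ∀ i, (a i).Partition)
    (z : m.Partition → ℤ)
    (hz : ∏ i, schur (diagram (α i)) = ∑ p, z p • schur (diagram p)) :
    multiLR p α = ∑ q, if diagram q = diagram p then z q else 0 := by
  rw [multiLR, hz, hallInner_schur_sum]

theorem multiLR_eq {p : n.Partition} {α : ∀ i, (a i).Partition} {z : n.Partition → ℤ}
    (hz : ∏ i, schur (diagram (α i)) = ∑ p, z p • schur (diagram p)) :
    multiLR p α = z p := by
  rw [multiLR_of_prod_eq p α z hz]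
  simp [diagram_injective.eq_iff]

theorem multiLR_eq_pairing (p : n.Partition) (α : ∀ i, (a i).Partition)
    (e : (Σ i, Fin (a i)) ≃ Fin n) :
    (multiLR p α : ℂ) = pairing (chiProd α) (fun h => chi p (youngEmb e h)) := by
  obtain ⟨z, hz, hz'⟩ := exists_prod_schur_eq α e
  rw [multiLR_eq hz, (hz' p).2]

theorem multiLR_eq_zero (p : n.Partition) (α : ∀ i, (a i).Partition) (h : ∑ i, a i ≠ n) :
    multiLR p α = 0 := by
  obtain ⟨e⟩ := exists_blockEquiv a rfl
  obtain ⟨z, hz, -⟩ := exists_prod_schur_eq α e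
  rw [multiLR_of_prod_eq p α z hz]
  refine Finset.sum_eq_zero fun q _ => if_neg fun hq => h ?_
  rw [← card_diagram q, hq, card_diagram]

theorem multiLR_nonneg (p : n.Partition) (α : ∀ i, (a i).Partition) : 0 ≤ multiLR p α := by
  by_cases h : ∑ i, a i = n
  · obtain ⟨e⟩ := exists_blockEquiv a h
    obtain ⟨z, hz, hz'⟩ := exists_prod_schur_eq α e
    rw [multiLR_eq hz]
    exact (hz' p).1
  · rw [multiLR_eq_zero p α h]

theorem card_parts_eq {m : ℕ} (p : m.Partition) : p.parts.card = (diagram p).colLen 0 := by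
  rw [← rowLens_diagram, Multiset.coe_card, YoungDiagram.length_rowLens]

/-- If `s_p` occurs in a product of Schur functions, then none of the factors has more rows than
`p`: the product contains the monomial of `p`, which involves only the first `ℓ(p)` variables. -/
theorem card_parts_le_of_multiLR_pos {p : n.Partition} {α : ∀ i, (a i).Partition}
    (h : 0 < multiLR p α) (i : Fin k) : (α i).parts.card ≤ p.parts.card := by
  classical
  have hsum : ∑ i, a i = n := by
    by_contra hne
    rw [multiLR_eq_zero p α hne] at h
    exact h.false
  obtain ⟨e⟩ := exists_blockEquiv a hsum
  obtain ⟨z, hz, hz'⟩ := exists_prod_schur_eq α e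
  rw [multiLR_eq hz] at h
  have hpos : 0 < MvPowerSeries.coeff (rowContent (diagram p)) (∏ i, schur (diagram (α i))) := by
    rw [hz, map_sum]
    refine Finset.sum_pos' (fun q _ => ?_) ⟨p, Finset.mem_univ p, ?_⟩
    · rw [map_zsmul, coeff_schur, smul_eq_mul]
      exact mul_nonneg (hz' q).1 (Nat.cast_nonneg _)
    · rw [map_zsmul, coeff_schur, kostka_self, smul_eq_mul, Nat.cast_one, mul_one]
      exact h
  rw [MvPowerSeries.coeff_prod] at hpos
  obtain ⟨A, hA, hne⟩ := Finset.exists_ne_zero_of_sum_ne_zero hpos.ne'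
  have hi : kostka (diagram (α i)) (A i) ≠ 0 := by
    have := Finset.prod_ne_zero_iff.1 hne i (Finset.mem_univ i)
    rw [coeff_schur] at this
    exact_mod_cast this
  rw [card_parts_eq, card_parts_eq]
  refine colLen_le_of_kostka_ne_zero hi fun j hj => ?_
  have h0 : rowContent (diagram p) j = 0 := by
    rw [rowContent_apply]
    by_contra hne
    have h1 := YoungDiagram.mem_iff_lt_rowLen.2 (Nat.pos_of_ne_zero hne)
    have h2 := YoungDiagram.mem_iff_lt_colLen.1 h1
    omega
  rw [← (Finset.mem_finsuppAntidiag.1 hA).1, Finsupp.finsetSum_apply] at h0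
  exact Finset.sum_eq_zero_iff.1 h0 i (Finset.mem_univ i)

end LR

/-! ### The coefficients of the Kronecker product -/

theorem monomialCoeff_eq {k : ℕ} (a : Fin k → ℕ) (f : MvPowerSeries ℕ ℤ) :
    monomialCoeff a f = MvPowerSeries.coeff (expo a) f :=
  MvPowerSeries.coeff_killCompl f _

theorem coeff_kronProd {n : ℕ} (μ ν : n.Partition) (d : ℕ →₀ ℕ) :
    MvPowerSeries.coeff d (kronProd μ ν) = ∑ r, (kron μ ν r : ℤ) * kostka (diagram r) d := by
  rw [kronProd, map_sum]
  rfl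

theorem coeff_kronProd_eq_zero {n : ℕ} (μ ν : n.Partition) {d : ℕ →₀ ℕ} (hd : d.degree ≠ n) :
    MvPowerSeries.coeff d (kronProd μ ν) = 0 := by
  rw [coeff_kronProd]
  refine Finset.sum_eq_zero fun r _ => ?_
  have h : kostka (diagram r) d = 0 := by
    by_contra hne
    exact hd ((degree_of_kostka_ne_zero hne).trans (card_diagram r))
  rw [h, Nat.cast_zero, mul_zero]

/-- The coefficient of `x^a` is the pairing of `χ_μ χ_ν` with the permutation character of `a`, hence
the pairing of the restrictions of `χ_μ` and `χ_ν` to the Young subgroup of `a`, which Parseval's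
identity evaluates. -/
theorem coeff_kronProd_expo {n : ℕ} (μ ν : n.Partition) {k : ℕ} (a : Fin k → ℕ) :
    MvPowerSeries.coeff (expo a) (kronProd μ ν) =
      ∑ α : (∀ i, (a i).Partition), multiLR μ α * multiLR ν α := by
  by_cases h : ∑ i, a i = n
  · obtain ⟨e⟩ := exists_blockEquiv a h
    apply Int.cast_injective (α := ℂ)
    rw [coeff_kronProd]
    push_cast
    simp only [← pairing_chi_tensor, ← pairing_chi_permChar, multiLR_eq_pairing _ _ e]
    rw [← pairing_eq_sum _ _ (permChar_conj _), pairing_permChar_expo e, sum_pairing_chiProd]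
    · simp only [pairing, mul_one]
    · intro σ τ
      rw [map_mul, map_mul, map_inv, chi_conj]
    · intro g h
      rw [chi_conj, chi_conj]
  · rw [coeff_kronProd_eq_zero μ ν (by rwa [degree_expo]), eq_comm]
    exact Finset.sum_eq_zero fun α _ => by rw [multiLR_eq_zero μ α h, zero_mul]

/-! ### Symmetry -/

theorem exists_equiv_of_map_eq {d d' : ℕ →₀ ℕ}
    (h : d.support.val.map d = d'.support.val.map d') :
    ∃ τ : d.support ≃ d'.support, ∀ x, d' (τ x) = d x := by
  have hmap : ∀ c : ℕ →₀ ℕ,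
      (Finset.univ : Finset {x // x ∈ c.support}).val.map (fun x : {x // x ∈ c.support} => c x) =
        c.support.val.map c :=
    fun c => Multiset.attach_map_val' c.support.val c
  have hc : content (fun x : {x // x ∈ d.support} => d x) =
      content (fun x : {x // x ∈ d'.support} => d' x) := by
    rw [content_eq_toFinsupp, content_eq_toFinsupp, hmap, hmap, h]
  obtain ⟨τ, hτ⟩ := exists_equiv_of_content_eq hc
  exact ⟨τ, fun x => (congrFun hτ x).symm⟩

theorem degree_eq_sum_map (d : ℕ →₀ ℕ) : d.degree = (d.support.val.map d).sum := by
  rw [Finsupp.degree_apply]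
  rfl

/-- The Schur functions are symmetric: by Young's rule a Kostka number is the pairing of a class
function with a permutation character, and renaming letters does not change the stabilizer of a
word. -/
theorem kostka_congr {n : ℕ} (p : n.Partition) {d d' : ℕ →₀ ℕ}
    (h : d.support.val.map d = d'.support.val.map d') :
    kostka (diagram p) d = kostka (diagram p) d' := by
  have hdeg : d.degree = d'.degree := by rw [degree_eq_sum_map, degree_eq_sum_map, h]
  by_cases hd : d.degree = n
  · obtain ⟨τ, hτ⟩ := exists_equiv_of_map_eq h
    obtain ⟨w, rfl⟩ := exists_content_eq d hd
    have hw : ∀ e, w e ∈ (content w).support := by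
      intro e
      rw [Finsupp.mem_support_iff, content_apply]
      exact Finset.card_ne_zero_of_mem (Finset.mem_filter.2 ⟨Finset.mem_univ e, rfl⟩)
    have hcw : content (fun e => (τ ⟨w e, hw e⟩ : ℕ)) = d' := by
      ext j
      rw [content_apply]
      by_cases hj : j ∈ d'.support
      · obtain ⟨i, hi⟩ := τ.surjective ⟨j, hj⟩
        have hij : d' j = content w i := by rw [← hτ i, hi]
        rw [hij, content_apply]
        congr 1
        ext e
        have : (τ ⟨w e, hw e⟩ : ℕ) = j ↔ w e = i := by
          rw [show j = (τ i : ℕ) by rw [hi], Subtype.coe_inj, τ.injective.eq_iff, Subtype.ext_iff]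
        simp [this]
      · rw [Finsupp.notMem_support_iff.1 hj, Finset.card_eq_zero, Finset.filter_eq_empty_iff]
        intro e _ he
        exact hj (he ▸ (τ ⟨w e, hw e⟩).2)
    have hstab : wordStab (fun e => (τ ⟨w e, hw e⟩ : ℕ)) = wordStab w := by
      ext σ
      rw [mem_wordStab, mem_wordStab, funext_iff, funext_iff]
      refine forall_congr' fun e => ?_
      simp only [Function.comp_apply]
      rw [Subtype.coe_inj, τ.injective.eq_iff, Subtype.mk.injEq]
    apply Nat.cast_injective (R := ℂ)
    rw [← pairing_chi_permChar, ← pairing_chi_permChar, ← hcw,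
      pairing_permChar _ _ (chi_conj p), pairing_permChar _ _ (chi_conj p), hstab]
  · have hzero : ∀ c : ℕ →₀ ℕ, c.degree ≠ n → kostka (diagram p) c = 0 := by
      intro c hc
      by_contra hne
      exact hc ((degree_of_kostka_ne_zero hne).trans (card_diagram p))
    rw [hzero d hd, hzero d' (hdeg ▸ hd)]

theorem coeff_kronProd_congr {n : ℕ} (μ ν : n.Partition) {d d' : ℕ →₀ ℕ}
    (h : d.support.val.map d = d'.support.val.map d') :
    MvPowerSeries.coeff d (kronProd μ ν) = MvPowerSeries.coeff d' (kronProd μ ν) := by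
  rw [coeff_kronProd, coeff_kronProd]
  exact Finset.sum_congr rfl fun r _ => by rw [kostka_congr r h]

/-! ### The monomial expansion -/

theorem map_support_expo {k : ℕ} (a : Fin k → ℕ) :
    (expo a).support.val.map (expo a) = (Finset.univ.val.map a).filter (· ≠ 0) := by
  have h : (Finsupp.equivFunOnFinite.symm a).support = Finset.univ.filter fun i => a i ≠ 0 := by
    ext i
    simp
  rw [expo, Finsupp.support_embDomain, Finset.map_val, Multiset.map_map, h, Finset.filter_val,
    Multiset.filter_map]
  refine Multiset.map_congr rfl fun i _ => ?_
  exact Finsupp.embDomain_apply_self Fin.valEmbedding (Finsupp.equivFunOnFinite.symm a) i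

theorem exists_map_support_eq {n : ℕ} (θ : n.Partition) :
    ∃ d : ℕ →₀ ℕ, d.support.val.map d = θ.parts := by
  obtain ⟨l, hl⟩ := Quot.exists_rep θ.parts
  refine ⟨expo l.get, ?_⟩
  rw [map_support_expo, Fin.univ_val_map, List.ofFn_get]
  change Multiset.filter _ (Quot.mk _ l) = _
  rw [hl, Multiset.filter_eq_self]
  exact fun x hx => (θ.parts_pos hx).ne'

theorem exists_monomialSymm_expansion {n : ℕ} (μ ν : n.Partition) :
    ∃ C : n.Partition → ℤ, kronProd μ ν = ∑ θ, C θ • monomialSymm θ ∧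
      ∀ (θ : n.Partition) (d : ℕ →₀ ℕ), d.support.val.map d = θ.parts →
        C θ = MvPowerSeries.coeff d (kronProd μ ν) := by
  choose D hD using exists_map_support_eq (n := n)
  refine ⟨fun θ => MvPowerSeries.coeff (D θ) (kronProd μ ν), ?_,
    fun θ d hd => coeff_kronProd_congr μ ν ((hD θ).trans hd.symm)⟩
  ext d
  have h1 : ∀ θ : n.Partition, MvPowerSeries.coeff d (monomialSymm θ) =
      if d.support.val.map d = θ.parts then 1 else 0 := fun _ => rfl
  simp only [map_sum, map_zsmul, h1, smul_eq_mul, mul_ite, mul_one, mul_zero]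
  by_cases hd : d.degree = n
  · let θ : n.Partition := ⟨d.support.val.map d, by
      intro i hi
      obtain ⟨x, hx, rfl⟩ := Multiset.mem_map.1 hi
      exact Nat.pos_of_ne_zero (Finsupp.mem_support_iff.1 hx), by rw [← degree_eq_sum_map, hd]⟩
    rw [Finset.sum_eq_single θ, if_pos rfl]
    · exact coeff_kronProd_congr μ ν (hD θ).symm
    · intro s _ hs
      exact if_neg fun h => hs (Nat.Partition.ext h.symm)
    · simp
  · rw [coeff_kronProd_eq_zero μ ν hd, Finset.sum_eq_zero]
    intro s _
    refine if_neg fun h => hd ?_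
    rw [degree_eq_sum_map, h, s.parts_sum]

theorem mem_monomialSet_kronProd {n : ℕ} (μ ν : n.Partition) {k : ℕ} (a : Fin k → ℕ) :
    a ∈ monomialSet k (kronProd μ ν) ↔
      ∃ α : (∀ i, (a i).Partition), 0 < multiLR μ α ∧ 0 < multiLR ν α := by
  have hnn : ∀ α : (∀ i, (a i).Partition), 0 ≤ multiLR μ α * multiLR ν α := fun α =>
    mul_nonneg (multiLR_nonneg μ α) (multiLR_nonneg ν α)
  change 0 < monomialCoeff a (kronProd μ ν) ↔ _
  rw [monomialCoeff_eq, coeff_kronProd_expo, Finset.sum_pos_iff_of_nonneg fun α _ => hnn α]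
  refine exists_congr fun α => ?_
  rw [(hnn α).lt_iff_ne', (multiLR_nonneg μ α).lt_iff_ne', (multiLR_nonneg ν α).lt_iff_ne',
    mul_ne_zero_iff]
  simp

end KronMonomials

end

theorem mainTheorem9 {n : ℕ} (μ ν : n.Partition) :
    -- the coefficient of `m_a` in the monomial expansion, for every composition `a` of `n`
    (∃ C : n.Partition → ℤ,
      KronMonomials.kronProd μ ν = ∑ θ : n.Partition, C θ • KronMonomials.monomialSymm θ ∧
      ∀ (k : ℕ) (a : Fin k → ℕ) (h : (Multiset.map a Finset.univ.val).sum = n),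
        C (Nat.Partition.ofSums n (Multiset.map a Finset.univ.val) h) =
          ∑ α : (∀ i, (a i).Partition), KronMonomials.multiLR μ α * KronMonomials.multiLR ν α) ∧
    -- the coefficient of `x^a`, for every exponent vector `a`
    (∀ (k : ℕ) (a : Fin k → ℕ),
      KronMonomials.monomialCoeff a (KronMonomials.kronProd μ ν) =
        ∑ α : (∀ i, (a i).Partition), KronMonomials.multiLR μ α * KronMonomials.multiLR ν α) ∧
    -- the monomials that appear in the product
    (∀ (k : ℕ) (a : Fin k → ℕ),
      a ∈ KronMonomials.monomialSet k (KronMonomials.kronProd μ ν) ↔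
        ∃ α : (∀ i, (a i).Partition),
          0 < KronMonomials.multiLR μ α ∧ 0 < KronMonomials.multiLR ν α) ∧
    (∀ k : ℕ,
      KronMonomials.monomialSet k (KronMonomials.kronProd μ ν) =
        {a | (KronMonomials.lrSet μ a ∩ KronMonomials.lrSet ν a).Nonempty}) := by
  obtain ⟨C, hC, hC'⟩ := KronMonomials.exists_monomialSymm_expansion μ ν
  refine ⟨⟨C, hC, fun k a h => ?_⟩, fun k a => ?_,
    fun k a => KronMonomials.mem_monomialSet_kronProd μ ν a, fun k => ?_⟩
  · rw [← KronMonomials.coeff_kronProd_expo]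
    exact hC' _ _ (KronMonomials.map_support_expo a)
  · rw [KronMonomials.monomialCoeff_eq, KronMonomials.coeff_kronProd_expo]
  · ext a
    rw [KronMonomials.mem_monomialSet_kronProd]
    constructor
    · rintro ⟨α, hμ, hν⟩
      exact ⟨α, ⟨KronMonomials.card_parts_le_of_multiLR_pos hμ, hμ⟩,
        ⟨KronMonomials.card_parts_le_of_multiLR_pos hν, hν⟩⟩
    · rintro ⟨α, hμ, hν⟩
      exact ⟨α, hμ.2, hν.2⟩
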